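/- Let $d\ge 1$, let $(n_k)_{k\ge1}$ be integers with $n_k\ge 2$, and for $k\ge 1$, $1\le j\le n_k$ let $T_{k,j}$ be non-singular linear maps of $\mathbb{R}^d$ whose smallest singular values are bounded below by a common positive constant. Let $\Sigma^k$ be the set of words $u_1\cdots u_k$ with $1\le u_i\le n_i$, $\Sigma^*=\bigcup_{k\ge 0}\Sigma^k$, $\Sigma^\infty$ the set of infinite words $u_1u_2\cdots$ with $1\le u_i\le n_i$, $\mathcal C_{\mathbf u}\subset\Sigma^\infty$ the cylinder of infinite words beginning with $\mathbf u$, and $T_{\mathbf u}=T_{1,u_1}\cdots T_{k,u_k}$ for $\mathbf u\in\Sigma^k$. For a linear map $T$ of $\mathbb{R}^d$ with singular values $\alpha_1\ge\dots\ge\alpha_d$ put $\phi^0(T)=1$, $\phi^s(T)=\alpha_1\cdots\alpha_{m-1}\alpha_m^{\,s-m+1}$ for $0<s\le d$, where $m=\lceil s\rceil$, and $\phi^s(T)=(\alpha_1\cdots\alpha_d)^{s/d}$ for $s>d$. Define $$\mathcal M^s(\Sigma^\infty)=\lim_{k\to\infty}\inf\Big\{\sum_{\mathbf u\in A}\phi^s(T_{\mathbf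 u}) : A\subset\Sigma^*,\ |\mathbf u|\ge k \text{ for all } \mathbf u\in A,\ \Sigma^\infty\subset\bigcup_{\mathbf u\in A}\mathcal C_{\mathbf u}\Big\},\qquad s_A=\inf\{s\ge 0:\mathcal M^s(\Sigma^\infty)=0\}.$$ Let $\tau\ge 1$ and to every non-empty word $\mathbf u\in\Sigma^*$ assign an index $\gamma(\mathbf u)\in\{1,\dots,\tau\}$ such that, for each $k\ge1$ and $\mathbf u\in\Sigma^{k-1}$, the indices $\gamma(\mathbf u1),\dots,\gamma(\mathbf un_k)$ are pairwise distinct. For $\mathbf a=(a_1,\dots,a_\tau)\in(\mathbb{R}^d)^\tau=\mathbb{R}^{\tau d}$ let $\Psi_\emptyset=\mathrm{id}$ and $\Psi_{\mathbf uj}(x)=\Psi_{\mathbf u}(T_{k,j}x+a_{\gamma(\mathbf uj)})$ for $\mathbf u\in\Sigma^{k-1}$, $1\le j\le n_k$. Call a compact set $J\subset\mathbb{R}^d$ with non-empty interior admissible for $\mathbf a$ if $\Psi_{\mathbf uj}(J)\subset\Psi_{\mathbf u}(J)$ for all such $\mathbf u,j$ and $\lim_{k\to\infty}\max_{\mathbf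 u\in\Sigma^k}\operatorname{diam}\Psi_{\mathbf u}(J)=0$; the corresponding self-affine Moran set is $E^{\mathbf a}=\bigcap_{k\ge1}\bigcup_{\mathbf u\in\Sigma^k}\Psi_{\mathbf u}(J)$. Suppose that $\sup\{\|T_{k,j}\| : k\ge 1,\ 1\le j\le n_k\}<\tfrac12$ (Euclidean operator norm). Then for $\mathcal L^{\tau d}$-almost all $\mathbf a\in\mathbb{R}^{\tau d}$ an admissible $J$ exists, and for every admissible $J$: (1) $\dim_{\rm H}E^{\mathbf a}=s_A$ if $s_A\le d$; (2) $\mathcal L^d(E^{\mathbf a})>0$ if $s_A>d$. -/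

import Mathlib

open MeasureTheory Filter Topology
open scoped NNReal ENNReal

noncomputable section

/-- Words of length `k`.  Levels are numbered from `0`: the letter in position `i` is one of the
`n i` elements of `Fin (n i)`. -/
abbrev MoranWord (n : ℕ → ℕ) (k : ℕ) : Type := (i : Fin k) → Fin (n i)

/-- Infinite words. -/
abbrev MoranInfWord (n : ℕ → ℕ) : Type := (k : ℕ) → Fin (n k)

namespace MoranWord

variable {n : ℕ → ℕ} {k : ℕ}

/-- The word `u⁻`, i.e. `u` without its last letter. -/
def init (u : MoranWord n (k + 1)) : MoranWord n k := fun i => u i.castSucc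

/-- The last letter of a non-empty word. -/
def last (u : MoranWord n (k + 1)) : Fin (n k) := u (Fin.last k)

/-- The cylinder of the infinite words that begin with `u`. -/
def cylinder (u : MoranWord n k) : Set (MoranInfWord n) := {v | ∀ i : Fin k, v i = u i}

end MoranWord

/-- Singular value function `φ^s` on `ℝ^d`.  Mathlib's singular values are decreasing and indexed
from `0`, so `α_i` is `singularValues (i - 1)`.  For `0 < s ≤ d`, with `m = ⌈s⌉`, it is
`α_1 ⋯ α_{m-1} α_m ^ (s - m + 1)`; for `s > d` it is `(α_1 ⋯ α_d) ^ (s / d)`; and `φ^0 = 1`. -/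
def singularValueFunction {d : ℕ} (s : ℝ≥0)
    (T : EuclideanSpace ℝ (Fin d) →L[ℝ] EuclideanSpace ℝ (Fin d)) : ℝ :=
  if s = 0 then 1
  else if s ≤ d then
    (∏ i ∈ Finset.range (⌈s⌉₊ - 1), T.toLinearMap.singularValues i) *
      T.toLinearMap.singularValues (⌈s⌉₊ - 1) ^ ((s : ℝ) - (⌈s⌉₊ : ℝ) + 1)
  else (∏ i ∈ Finset.range d, T.toLinearMap.singularValues i) ^ ((s : ℝ) / (d : ℝ))

section Moran

variable {d : ℕ} {n : ℕ → ℕ}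
  (T : ∀ k, Fin (n k) → (EuclideanSpace ℝ (Fin d) →L[ℝ] EuclideanSpace ℝ (Fin d)))
  (w : ∀ k, MoranWord n k → Fin (n k) → EuclideanSpace ℝ (Fin d))

/-- The product `T_u` of the linear parts along the word `u`. -/
def moranLinear : (k : ℕ) → MoranWord n k →
    (EuclideanSpace ℝ (Fin d) →L[ℝ] EuclideanSpace ℝ (Fin d))
  | 0, _ => ContinuousLinearMap.id ℝ _
  | k + 1, u => (moranLinear k u.init).comp (T k u.last)

/-- The affine map `Ψ_u`: `Ψ_∅ = id` and `Ψ_{uj}(x) = Ψ_u (T_{k,j} x + ω_{uj})`, where the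
translation `ω_{uj}` is `w k u j`. -/
def moranMap : (k : ℕ) → MoranWord n k → EuclideanSpace ℝ (Fin d) → EuclideanSpace ℝ (Fin d)
  | 0, _ => id
  | k + 1, u => fun x => moranMap k u.init (T k u.last x + w k u.init u.last)

/-- The basic set `J_u = Ψ_u(J)`. -/
def moranBasicSet (J : Set (EuclideanSpace ℝ (Fin d))) (k : ℕ) (u : MoranWord n k) :
    Set (EuclideanSpace ℝ (Fin d)) :=
  moranMap T w k u '' J

/-- The collection `{Ψ_u(J)}` fulfils the self-affine Moran structure. -/
structure IsSelfAffineMoran (J : Set (EuclideanSpace ℝ (Fin d))) : Prop where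
  isCompact : IsCompact J
  interior_nonempty : (interior J).Nonempty
  nested : ∀ (k : ℕ) (u : MoranWord n (k + 1)),
    moranBasicSet T w J (k + 1) u ⊆ moranBasicSet T w J k u.init
  diam_tendsto : Tendsto (fun k => ⨆ u : MoranWord n k, Metric.diam (moranBasicSet T w J k u))
    atTop (𝓝 0)

/-- The self-affine Moran set `E = ⋂_{k ≥ 1} ⋃_{|u| = k} J_u`. -/
def moranSet (J : Set (EuclideanSpace ℝ (Fin d))) : Set (EuclideanSpace ℝ (Fin d)) :=
  ⋂ k : ℕ, ⋃ u : MoranWord n (k + 1), moranBasicSet T w J (k + 1) u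

/-- `M^s_{(k)}(G)`: infimum of `∑ φ^s(T_u)` over the covers of `G` by cylinders of words of length
at least `k`. -/
def netPremeasure (s : ℝ≥0) (k : ℕ) (G : Set (MoranInfWord n)) : ℝ≥0∞ :=
  ⨅ (A : Set (Σ l : ℕ, MoranWord n l)) (_ : ∀ u ∈ A, k ≤ u.1)
    (_ : G ⊆ ⋃ u ∈ A, u.2.cylinder),
    ∑' u : A, ENNReal.ofReal (singularValueFunction s (moranLinear T u.1.1 u.1.2))

/-- `M^s(G)`: the limit of the sequence `M^s_{(k)}(G)`, non-decreasing in `k`, as `k → ∞`. -/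
def netMeasure (s : ℝ≥0) (G : Set (MoranInfWord n)) : ℝ≥0∞ := ⨆ k : ℕ, netPremeasure T s k G

/-- The critical value `s_A = inf {s ≥ 0 : M^s(Σ^∞) = 0}`. -/
def criticalValue : ℝ≥0∞ := ⨅ (s : ℝ≥0) (_ : netMeasure T s Set.univ = 0), (s : ℝ≥0∞)

end Moran

end

/-! The upper bound holds for every `a`. A basic set `Ψ_u(J)` lies in a translate of the ellipsoid
`T_u(B)`, `B` a ball. With `m = ⌈s⌉`, that ellipsoid splits into about `φ^s(T_u) / α_m^s` pieces of
diameter comparable to `α_m`. Cheap covers of `Σ^∞` by cylinders thus become cheap covers of `E`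
(`exists_cover_image_closedBall`, `hausdorffMeasure_moranSet_eq_zero`).

For the lower bounds, let `M^s(Σ^∞) ≠ 0`. Frostman's lemma on the word tree gives a probability `μ`
with `μ(C_u) ≤ C φ^s(T_u)`. Push it to `E` by the coding map `π_a` and average over `a` in a ball
the measure of the pairs at distance at most `r`. The essential estimate is transversality
(`exists_volume_norm_codingMap_sub_le`): if `u`, `v` have longest common prefix `p`, the parameters
in the ball with `|π_a(u) - π_a(v)| ≤ r` have volume at most `C r^t / φ^t(T_p)`. Indeed `π_a(u) -
π_a(v) = T_p(G(a))` with `G` linear, and `G` is expanding along a `d`-dimensional family of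
directions: add `y` to one of the two translations following `p`, subtract it from the other. The
leading term changes by `2y`, the tails by at most `2 η / (1 - η) |y|`, which is smaller exactly
when `η < 1/2`.

Since `φ^s(T_p) ≤ θ^|p| φ^t(T_p)` with `θ < 1` when `t < s`, `t ≤ d`, summation over `p` bounds the
mean correlation by `C' r^t`. For `s ≤ d`, dyadic sums of correlations converge for almost every
`a`, and mass distribution gives positive Hausdorff measure in every dimension below `s`. For `s >
d`, take `t = d`; Fatou's lemma and differentiation of measures give positive volume. -/

noncomputable section

/-! ### Singular values, `φ^s`, and the geometry of linear images of balls -/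

section SingularValues

variable {d : ℕ} (T : EuclideanSpace ℝ (Fin d) →L[ℝ] EuclideanSpace ℝ (Fin d))

/-- In an orthonormal basis of eigenvectors of `T* T`, the norm of `T x` is given by the singular
values. -/
theorem exists_orthonormalBasis_norm_sq_eq :
    ∃ e : OrthonormalBasis (Fin d) ℝ (EuclideanSpace ℝ (Fin d)),
      ∀ x, ‖T x‖ ^ 2 = ∑ i : Fin d, (T.toLinearMap.singularValues i * inner ℝ (e i) x) ^ 2 := by
  have hn : Module.finrank ℝ (EuclideanSpace ℝ (Fin d)) = d := by simp
  have hS := T.toLinearMap.isSymmetric_adjoint_comp_self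
  refine ⟨hS.eigenvectorBasis hn, fun x => ?_⟩
  set e := hS.eigenvectorBasis hn with he
  have h1 : ‖T x‖ ^ 2 = inner ℝ x ((LinearMap.adjoint T.toLinearMap ∘ₗ T.toLinearMap) x) := by
    rw [LinearMap.comp_apply, LinearMap.adjoint_inner_right, ← real_inner_self_eq_norm_sq]
    rfl
  rw [h1, ← e.sum_inner_mul_inner]
  refine Finset.sum_congr rfl fun i _ => ?_
  have h2 := hS.eigenvectorBasis_apply_self_apply hn x i
  rw [← he, e.repr_apply_apply, e.repr_apply_apply] at h2
  rw [h2, real_inner_comm, mul_pow, T.toLinearMap.sq_singularValues_fin hn i]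
  simp only [RCLike.ofReal_real_eq_id, id_eq]
  ring

theorem singularValues_mul_abs_inner_le {e : OrthonormalBasis (Fin d) ℝ (EuclideanSpace ℝ (Fin d))}
    (he : ∀ x, ‖T x‖ ^ 2 = ∑ i : Fin d, (T.toLinearMap.singularValues i * inner ℝ (e i) x) ^ 2)
    (x : EuclideanSpace ℝ (Fin d)) (i : Fin d) :
    T.toLinearMap.singularValues i * |inner ℝ (e i) x| ≤ ‖T x‖ := by
  rw [← abs_of_nonneg (T.toLinearMap.singularValues_nonneg i), ← abs_mul]
  refine abs_le_of_sq_le_sq ?_ (norm_nonneg _)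
  rw [he x]
  exact Finset.single_le_sum (f := fun i : Fin d =>
    (T.toLinearMap.singularValues i * inner ℝ (e i) x) ^ 2) (fun _ _ => sq_nonneg _)
    (Finset.mem_univ i)

theorem singularValues_le_opNorm (i : ℕ) : T.toLinearMap.singularValues i ≤ ‖T‖ := by
  rcases lt_or_ge i d with hi | hi
  · obtain ⟨e, he⟩ := exists_orthonormalBasis_norm_sq_eq T
    have h := singularValues_mul_abs_inner_le T he (e ⟨i, hi⟩) ⟨i, hi⟩
    have h2 := T.le_opNorm (e ⟨i, hi⟩)
    simp only [OrthonormalBasis.norm_eq_one, mul_one, inner_self_eq_norm_sq_to_K] at h h2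
    simp at h
    exact h.trans h2
  · rw [T.toLinearMap.singularValues_of_finrank_le (by simpa using hi)]
    exact norm_nonneg _

theorem singularValues_pos_of_injective (hT : Function.Injective T) {i : ℕ} (hi : i < d) :
    0 < T.toLinearMap.singularValues i :=
  T.toLinearMap.injective_iff_forall_lt_finrank_singularValues_pos.1 hT i (by simpa using hi)

theorem injective_of_singularValues_pos (h : 0 < T.toLinearMap.singularValues (d - 1)) :
    Function.Injective T :=
  T.toLinearMap.injective_iff_forall_lt_finrank_singularValues_pos.2 fun i hi =>
    h.trans_le (T.toLinearMap.singularValues_antitone (by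
      simp only [finrank_euclideanSpace, Fintype.card_fin] at hi; omega))

/-- The exponent of the singular value of index `i` in `φ^s`. -/
def svExponent (s : ℝ) (i : ℕ) : ℝ := max 0 (min 1 (s - i))

theorem svExponent_nonneg (s : ℝ) (i : ℕ) : 0 ≤ svExponent s i := le_max_left _ _

theorem svExponent_le_one (s : ℝ) (i : ℕ) : svExponent s i ≤ 1 :=
  max_le zero_le_one (min_le_left _ _)

theorem svExponent_mono {s t : ℝ} (h : s ≤ t) (i : ℕ) : svExponent s i ≤ svExponent t i :=
  max_le_max le_rfl (min_le_min le_rfl (by linarith))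

/-- Because the exponents add up to `s` when `s ≤ d`, a power `r ^ s` factors over the axes in the
same way as `φ^s`. Estimates on `φ^s` can then be made one axis at a time, without the ceiling. -/
theorem sum_svExponent {s : ℝ} (hs : 0 ≤ s) (d : ℕ) :
    ∑ i ∈ Finset.range d, svExponent s i = min s d := by
  induction d with
  | zero => simp [hs]
  | succ d ih =>
    rw [Finset.sum_range_succ, ih, svExponent]
    push_cast
    rcases le_total s d with h | h
    · rw [min_eq_left h, max_eq_left ((min_le_right _ _).trans (by linarith)),
        min_eq_left (by linarith), add_zero]
    · rw [min_eq_right h]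
      rcases le_total s (d + 1) with h' | h'
      · rw [min_eq_left h', min_eq_right (by linarith), max_eq_right (by linarith)]; ring
      · rw [min_eq_right h', min_eq_left (by linarith), max_eq_right (by linarith)]

theorem singularValueFunction_zero : singularValueFunction 0 T = 1 := by
  simp [singularValueFunction]

theorem singularValueFunction_eq_prod {s : ℝ≥0} (hs : s ≤ d) :
    singularValueFunction s T =
      ∏ i ∈ Finset.range d, T.toLinearMap.singularValues i ^ svExponent s i := by
  rcases eq_or_ne s 0 with rfl | h0
  · rw [singularValueFunction_zero, Finset.prod_eq_one]
    intro i _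
    have : svExponent ((0 : ℝ≥0) : ℝ) i = 0 := by
      rw [svExponent, max_eq_left]
      exact (min_le_right _ _).trans (by simp)
    rw [this, Real.rpow_zero]
  · have hpos : 0 < ⌈s⌉₊ := Nat.ceil_pos.2 (pos_iff_ne_zero.2 h0)
    obtain ⟨m, hm⟩ : ∃ m, ⌈s⌉₊ = m + 1 := ⟨⌈s⌉₊ - 1, by omega⟩
    have hmd : m + 1 ≤ d := hm ▸ Nat.ceil_le.2 hs
    have h1 : (s : ℝ) ≤ m + 1 := by
      have := Nat.le_ceil s
      rw [hm] at this
      exact_mod_cast this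
    have h2 : (m : ℝ) < s := by
      have : m < ⌈s⌉₊ := by omega
      exact_mod_cast Nat.lt_ceil.1 this
    rw [singularValueFunction, if_neg h0, if_pos hs, hm,
      ← Finset.prod_subset (Finset.range_subset_range.2 hmd), Finset.prod_range_succ]
    · congr 1
      · refine Finset.prod_congr rfl fun i hi => ?_
        have hi' : (i : ℝ) + 1 ≤ m := by
          have := Finset.mem_range.1 hi
          exact_mod_cast this
        rw [svExponent, min_eq_left (by linarith), max_eq_right zero_le_one, Real.rpow_one]
      · simp only [Nat.add_sub_cancel]
        rw [svExponent, min_eq_right (by linarith), max_eq_right (by linarith)]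
        congr 1
        push_cast
        ring
    · intro i _ hi
      have hi' : (m : ℝ) + 1 ≤ i := by
        have := Finset.mem_range.not.1 hi
        exact_mod_cast not_lt.1 this
      rw [svExponent, max_eq_left ((min_le_right _ _).trans (by linarith)), Real.rpow_zero]

theorem singularValueFunction_pos (hT : Function.Injective T) (s : ℝ≥0) :
    0 < singularValueFunction s T := by
  rcases le_or_gt s d with hs | hs
  · rw [singularValueFunction_eq_prod T hs]
    exact Finset.prod_pos fun i hi => Real.rpow_pos_of_pos
      (singularValues_pos_of_injective T hT (Finset.mem_range.1 hi)) _
  · rw [singularValueFunction, if_neg (by rintro rfl; simp at hs), if_neg hs.not_ge]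
    exact Real.rpow_pos_of_pos (Finset.prod_pos fun i hi =>
      singularValues_pos_of_injective T hT (Finset.mem_range.1 hi)) _

/-- On each axis the surplus exponent is nonnegative, and the singular value there is at most `‖T‖`.
For `T_u` this supplies a factor that decays geometrically in the length of `u`. -/
theorem singularValueFunction_le_of_le (hT : Function.Injective T) {s t : ℝ≥0} (hts : t ≤ s)
    (hs : s ≤ d) :
    singularValueFunction s T ≤ ‖T‖ ^ ((s : ℝ) - t) * singularValueFunction t T := by
  rcases Nat.eq_zero_or_pos d with rfl | hd
  · have hs0 : s = 0 := by simpa using hs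
    have ht0 : t = 0 := le_antisymm (hts.trans hs0.le) bot_le
    subst hs0 ht0
    simp
  have hσ : ∀ i ∈ Finset.range d, 0 < T.toLinearMap.singularValues i := fun i hi =>
    singularValues_pos_of_injective T hT (Finset.mem_range.1 hi)
  have hT0 : 0 < ‖T‖ := (hσ 0 (Finset.mem_range.2 hd)).trans_le (singularValues_le_opNorm T 0)
  have hsum : (s : ℝ) - t = ∑ i ∈ Finset.range d, (svExponent s i - svExponent t i) := by
    rw [Finset.sum_sub_distrib, sum_svExponent s.coe_nonneg, sum_svExponent t.coe_nonneg,
      min_eq_left, min_eq_left]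
    · exact_mod_cast hts.trans hs
    · exact_mod_cast hs
  rw [singularValueFunction_eq_prod T hs, singularValueFunction_eq_prod T (hts.trans hs), hsum,
    Real.rpow_sum_of_pos hT0, ← Finset.prod_mul_distrib]
  refine Finset.prod_le_prod (fun i hi => (Real.rpow_pos_of_pos (hσ i hi) _).le) fun i hi => ?_
  calc T.toLinearMap.singularValues i ^ svExponent s i
      = T.toLinearMap.singularValues i ^ (svExponent s i - svExponent t i) *
          T.toLinearMap.singularValues i ^ svExponent t i := by
        rw [← Real.rpow_add (hσ i hi), sub_add_cancel]
    _ ≤ _ := by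
        gcongr
        · exact Real.rpow_nonneg (hσ i hi).le _
        · exact (hσ i hi).le
        · exact sub_nonneg.2 (svExponent_mono (by exact_mod_cast hts) i)
        · exact singularValues_le_opNorm T i

theorem singularValueFunction_le_of_lt (hd : 0 < d) (hT : Function.Injective T) {s : ℝ≥0}
    (hs : (d : ℝ≥0) < s) :
    singularValueFunction s T ≤ ‖T‖ ^ ((s : ℝ) - d) * singularValueFunction d T := by
  have hσ : ∀ i ∈ Finset.range d, 0 < T.toLinearMap.singularValues i := fun i hi =>
    singularValues_pos_of_injective T hT (Finset.mem_range.1 hi)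
  have hprod : singularValueFunction d T = ∏ i ∈ Finset.range d, T.toLinearMap.singularValues i := by
    rw [singularValueFunction_eq_prod T le_rfl]
    refine Finset.prod_congr rfl fun i hi => ?_
    have : (i : ℝ) + 1 ≤ d := by exact_mod_cast Finset.mem_range.1 hi
    rw [svExponent, min_eq_left (by push_cast; linarith), max_eq_right zero_le_one, Real.rpow_one]
  have hpos := Finset.prod_pos hσ
  have hd' : (0 : ℝ) < d := by exact_mod_cast hd
  have hs' : (d : ℝ) < s := by exact_mod_cast hs
  rw [hprod, singularValueFunction, if_neg (by rintro rfl; simp at hs), if_neg hs.not_ge]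
  have h1 : (s : ℝ) / d = ((s : ℝ) - d) / d + 1 := by field_simp; ring
  rw [h1, Real.rpow_add hpos, Real.rpow_one]
  gcongr
  calc (∏ i ∈ Finset.range d, T.toLinearMap.singularValues i) ^ (((s : ℝ) - d) / d)
      ≤ (‖T‖ ^ (d : ℝ)) ^ (((s : ℝ) - d) / d) := by
        gcongr
        rw [Real.rpow_natCast]
        refine (Finset.prod_le_prod (fun i hi => (hσ i hi).le)
          fun i _ => singularValues_le_opNorm T i).trans ?_
        simp
    _ = ‖T‖ ^ ((s : ℝ) - d) := by
        rw [← Real.rpow_mul (norm_nonneg _)]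
        congr 1
        field_simp

theorem singularValueFunction_le_one (hT : Function.Injective T) (hT1 : ‖T‖ ≤ 1) {s : ℝ≥0}
    (hs : s ≤ d) : singularValueFunction s T ≤ 1 := by
  have h := singularValueFunction_le_of_le T hT (zero_le (a := s)) hs
  rw [singularValueFunction_zero, mul_one] at h
  exact h.trans (Real.rpow_le_one (norm_nonneg _) hT1 (by simp))

/-- The part of a ball that `T` maps into the ball of radius `r` has volume `O(r ^ t / φ^t(T))`. -/
theorem volume_norm_le_and_norm_sub_le (hT : Function.Injective T) {t : ℝ≥0} (ht : t ≤ d) {r R : ℝ}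
    (hr : 0 < r) (hR : 1 ≤ R) (x₀ : EuclideanSpace ℝ (Fin d)) :
    volume {x | ‖T x‖ ≤ r ∧ ‖x - x₀‖ ≤ R} ≤
      ENNReal.ofReal ((2 * R) ^ d * r ^ (t : ℝ) / singularValueFunction t T) := by
  obtain ⟨e, he⟩ := exists_orthonormalBasis_norm_sq_eq T
  set σ := T.toLinearMap.singularValues with hσdef
  have hσ : ∀ i : Fin d, 0 < σ i := fun i => singularValues_pos_of_injective T hT i.2
  set I : Fin d → Set ℝ := fun i =>
    Set.Icc (-(r / σ i)) (r / σ i) ∩ Set.Icc (inner ℝ (e i) x₀ - R) (inner ℝ (e i) x₀ + R) with hI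
  have hImeas : MeasurableSet (Set.univ.pi I) :=
    MeasurableSet.univ_pi fun i => measurableSet_Icc.inter measurableSet_Icc
  have hsub : {x | ‖T x‖ ≤ r ∧ ‖x - x₀‖ ≤ R} ⊆
      e.repr ⁻¹' ((@WithLp.ofLp 2 (Fin d → ℝ)) ⁻¹' (Set.univ.pi I)) := by
    rintro x ⟨hx, hx'⟩ i -
    have h1 : |inner ℝ (e i) x| ≤ r / σ i := by
      rw [le_div_iff₀ (hσ i), mul_comm]
      exact (singularValues_mul_abs_inner_le T he x i).trans hx
    have h2 : |inner ℝ (e i) (x - x₀)| ≤ R := by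
      refine (abs_real_inner_le_norm _ _).trans ?_
      rwa [e.norm_eq_one, one_mul]
    rw [inner_sub_right] at h2
    rw [abs_le] at h1 h2
    change e.repr x i ∈ I i
    rw [e.repr_apply_apply]
    exact ⟨⟨h1.1, h1.2⟩, ⟨by linarith, by linarith⟩⟩
  -- The side is at most `2 * min R (r / σ i)`. As `R ≥ 1`, this is bounded by `2 * R * q ^ e` with
  -- `q = r / σ i` for any exponent `e` in `[0, 1]`.
  have hvol : ∀ i, volume (I i) ≤ ENNReal.ofReal (2 * R * (r / σ i) ^ svExponent t i) := by
    intro i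
    have hq : 0 < r / σ i := div_pos hr (hσ i)
    rcases le_total 1 (r / σ i) with h | h
    · refine (measure_mono Set.inter_subset_right).trans ?_
      rw [Real.volume_Icc]
      refine ENNReal.ofReal_le_ofReal ?_
      have := Real.one_le_rpow h (svExponent_nonneg t i)
      nlinarith
    · refine (measure_mono Set.inter_subset_left).trans ?_
      rw [Real.volume_Icc]
      refine ENNReal.ofReal_le_ofReal ?_
      have := Real.rpow_le_rpow_of_exponent_ge hq h (svExponent_le_one t i)
      rw [Real.rpow_one] at this
      nlinarith
  calc volume {x | ‖T x‖ ≤ r ∧ ‖x - x₀‖ ≤ R}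
      ≤ volume (e.repr ⁻¹' ((@WithLp.ofLp 2 (Fin d → ℝ)) ⁻¹' (Set.univ.pi I))) := measure_mono hsub
    _ = volume (Set.univ.pi I) := by
        have h1 := PiLp.volume_preserving_ofLp (Fin d)
        rw [e.measurePreserving_repr.measure_preimage (h1.measurable hImeas).nullMeasurableSet,
          h1.measure_preimage hImeas.nullMeasurableSet]
    _ = ∏ i, volume (I i) := volume_pi_pi I
    _ ≤ ∏ i : Fin d, ENNReal.ofReal (2 * R * (r / σ i) ^ svExponent t i) :=
        Finset.prod_le_prod' fun i _ => hvol i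
    _ = ENNReal.ofReal (∏ i : Fin d, (2 * R * (r / σ i) ^ svExponent t i)) :=
        (ENNReal.ofReal_prod_of_nonneg fun i _ => mul_nonneg (by linarith)
          (Real.rpow_nonneg (div_pos hr (hσ i)).le _)).symm
    _ = _ := by
        congr 1
        have h1 : r ^ (t : ℝ) = ∏ i ∈ Finset.range d, r ^ svExponent t i := by
          rw [← Real.rpow_sum_of_pos hr, sum_svExponent t.coe_nonneg, min_eq_left]
          exact_mod_cast ht
        rw [singularValueFunction_eq_prod T ht, h1, Finset.prod_mul_distrib, mul_div_assoc,
          ← Finset.prod_div_distrib, ← Fin.prod_univ_eq_prod_range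
            (fun i => r ^ svExponent t i / T.toLinearMap.singularValues i ^ svExponent t i)]
        simp only [Finset.prod_const, Finset.card_univ, Fintype.card_fin]
        congr 1
        exact Finset.prod_congr rfl fun i _ => Real.div_rpow hr.le (hσ i).le _

/-- The image of a ball under `T` is covered by sets whose diameter is comparable to a singular
value, and whose number is controlled by `φ^s(T)`. -/
theorem exists_cover_image_closedBall (hT : Function.Injective T) {s : ℝ≥0} (h0 : s ≠ 0)
    (hs : s ≤ d) {R : ℝ} (hR : 0 < R) :
    ∃ (ι : Type) (_ : Fintype ι) (c : ι → Set (EuclideanSpace ℝ (Fin d))) (δ : ℝ),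
      0 ≤ δ ∧ δ ≤ ‖T‖ ∧ T '' Metric.closedBall 0 R ⊆ ⋃ i, c i ∧
      (∀ i, Metric.ediam (c i) ≤ ENNReal.ofReal (2 * R * √d * δ)) ∧
      Fintype.card ι * δ ^ (s : ℝ) ≤ 2 ^ d * singularValueFunction s T := by
  obtain ⟨e, he⟩ := exists_orthonormalBasis_norm_sq_eq T
  set σ := T.toLinearMap.singularValues with hσdef
  have hσ : ∀ i < d, 0 < σ i := fun i hi => singularValues_pos_of_injective T hT hi
  have hpos : 0 < ⌈s⌉₊ := Nat.ceil_pos.2 (pos_iff_ne_zero.2 h0)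
  obtain ⟨m, hm⟩ : ∃ m, ⌈s⌉₊ = m + 1 := ⟨⌈s⌉₊ - 1, by omega⟩
  have hmd : m + 1 ≤ d := hm ▸ Nat.ceil_le.2 hs
  have hs1 : (s : ℝ) ≤ m + 1 := by
    have := Nat.le_ceil s
    rw [hm] at this
    exact_mod_cast this
  have hs2 : (m : ℝ) < s := by
    have : m < ⌈s⌉₊ := by omega
    exact_mod_cast Nat.lt_ceil.1 this
  have hm0 : 0 < σ m := hσ m (by omega)
  -- Cells of the ball have widths chosen so that `T` makes every side equal to `2 * R * σ m`. Axes
  -- with `σ i < σ m` need only one cell.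
  set w : Fin d → ℝ := fun i => 2 * R * σ m / σ i with hw
  have hwpos : ∀ i, 0 < w i := fun i => div_pos (by positivity) (hσ i i.2)
  set q : Fin d → EuclideanSpace ℝ (Fin d) → ℝ := fun i x => (inner ℝ (e i) x + R) / w i with hq
  have hmem : ∀ x ∈ Metric.closedBall (0 : EuclideanSpace ℝ (Fin d)) R, ∀ i,
      0 ≤ q i x ∧ q i x ≤ σ i / σ m := by
    intro x hx i
    have h2 : |inner ℝ (e i) x| ≤ R := by
      refine (abs_real_inner_le_norm _ _).trans ?_
      rw [e.norm_eq_one, one_mul]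
      simpa using hx
    rw [abs_le] at h2
    refine ⟨div_nonneg (by linarith) (hwpos i).le, ?_⟩
    rw [hq, div_le_iff₀ (hwpos i), hw]
    have := hσ i i.2
    have : σ i / σ m * (2 * R * σ m / σ i) = 2 * R := by field_simp
    simp only
    rw [this]
    linarith
  refine ⟨(i : Fin d) → Fin (⌊σ i / σ m⌋₊ + 1), inferInstance,
    fun f => T '' {x ∈ Metric.closedBall 0 R | ∀ i, ⌊q i x⌋₊ = f i}, σ m, hm0.le,
    singularValues_le_opNorm T m, ?_, ?_, ?_⟩
  · rintro _ ⟨x, hx, rfl⟩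
    refine Set.mem_iUnion.2 ⟨fun i => ⟨⌊q i x⌋₊, Nat.lt_succ_of_le
      (Nat.floor_le_floor (hmem x hx i).2)⟩, x, ⟨hx, fun i => rfl⟩, rfl⟩
  · refine fun f => Metric.ediam_le ?_
    rintro _ ⟨x, ⟨hx, hxf⟩, rfl⟩ _ ⟨y, ⟨hy, hyf⟩, rfl⟩
    rw [edist_dist, dist_eq_norm, ← map_sub]
    refine ENNReal.ofReal_le_ofReal (le_of_sq_le_sq ?_ (by positivity))
    rw [he]
    have hterm : ∀ i : Fin d, (σ i * inner ℝ (e i) (x - y)) ^ 2 ≤ (2 * R * σ m) ^ 2 := by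
      intro i
      have hx1 := Nat.floor_le (hmem x hx i).1
      have hx2 := Nat.lt_floor_add_one (q i x)
      have hy1 := Nat.floor_le (hmem y hy i).1
      have hy2 := Nat.lt_floor_add_one (q i y)
      rw [hxf i] at hx1 hx2
      rw [hyf i] at hy1 hy2
      have hxy : q i x - q i y = σ i * inner ℝ (e i) (x - y) / (2 * R * σ m) := by
        have := (hσ i i.2).ne'
        simp only [hq, hw, inner_sub_right]
        field_simp
        ring
      have hle : |σ i * inner ℝ (e i) (x - y) / (2 * R * σ m)| ≤ 1 := by
        rw [← hxy, abs_le]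
        constructor <;> linarith
      rw [abs_div, abs_of_pos (show 0 < 2 * R * σ m by positivity),
        div_le_one (by positivity)] at hle
      rw [← sq_abs]
      gcongr
    refine (Finset.sum_le_sum fun i _ => hterm i).trans (le_of_eq ?_)
    simp only [Finset.sum_const, Finset.card_univ, Fintype.card_fin, nsmul_eq_mul]
    rw [show 2 * R * √d * σ m = (2 * R * σ m) * √d by ring, mul_pow _ (√d), Real.sq_sqrt (by simp)]
    ring
  · have hcard : (Fintype.card ((i : Fin d) → Fin (⌊σ i / σ m⌋₊ + 1)) : ℝ) ≤
        ∏ i ∈ Finset.range d, 2 * max 1 (σ i / σ m) := by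
      rw [Fintype.card_pi, Finset.prod_range]
      push_cast
      refine Finset.prod_le_prod (fun i _ => by positivity) fun i _ => ?_
      simp only [Fintype.card_fin, Nat.cast_add, Nat.cast_one]
      have h1 := Nat.floor_le (div_pos (hσ i i.2) hm0).le
      have h2 := le_max_left 1 (σ i / σ m)
      have h3 := le_max_right 1 (σ i / σ m)
      linarith
    have hsm : σ m ^ (s : ℝ) = ∏ i ∈ Finset.range d, σ m ^ svExponent s i := by
      rw [← Real.rpow_sum_of_pos hm0, sum_svExponent s.coe_nonneg, min_eq_left]
      exact_mod_cast hs
    calc _ ≤ (∏ i ∈ Finset.range d, 2 * max 1 (σ i / σ m)) * σ m ^ (s : ℝ) := by gcongr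
      _ = 2 ^ d * ∏ i ∈ Finset.range d, max 1 (σ i / σ m) * σ m ^ svExponent s i := by
          rw [hsm, Finset.prod_mul_distrib, Finset.prod_mul_distrib]
          simp [mul_assoc]
      _ = 2 ^ d * singularValueFunction s T := by
          rw [singularValueFunction_eq_prod T hs]
          congr 1
          refine Finset.prod_congr rfl fun i hi => ?_
          -- Before `m` the exponent is 1 and the ratio at least 1; after `m` the exponent is 0 and
          -- the ratio at most 1. Each factor is therefore exactly the one in `φ^s`.
          rcases lt_trichotomy i m with h | rfl | h
          · have h1 : (i : ℝ) + 1 ≤ m := by exact_mod_cast h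
            rw [svExponent, min_eq_left (by linarith), max_eq_right zero_le_one, Real.rpow_one,
              Real.rpow_one, max_eq_right, div_mul_cancel₀ _ hm0.ne']
            rw [one_le_div hm0]
            exact T.toLinearMap.singularValues_antitone h.le
          · rw [div_self hm0.ne', max_self, one_mul]
          · have h1 : (m : ℝ) + 1 ≤ i := by exact_mod_cast h
            rw [svExponent, max_eq_left ((min_le_right _ _).trans (by linarith)), Real.rpow_zero,
              Real.rpow_zero, max_eq_left, mul_one]
            rw [div_le_one hm0]
            exact T.toLinearMap.singularValues_antitone h.le

end SingularValues

/-! ### Moran maps and the upper bound for the dimension -/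

section MoranMaps

variable {d : ℕ} {n : ℕ → ℕ}

/-- The prefix of length `k` of an infinite word. -/
def MoranInfWord.take (u : MoranInfWord n) (k : ℕ) : MoranWord n k := fun i => u i

theorem MoranInfWord.init_take (u : MoranInfWord n) (k : ℕ) : (take u (k + 1)).init = take u k :=
  rfl

theorem MoranInfWord.last_take (u : MoranInfWord n) (k : ℕ) : (take u (k + 1)).last = u k := rfl

theorem MoranWord.mem_cylinder_iff {k : ℕ} (v : MoranWord n k) (u : MoranInfWord n) :
    u ∈ v.cylinder ↔ MoranInfWord.take u k = v :=
  funext_iff.symm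

theorem MoranInfWord.continuous_take (k : ℕ) : Continuous (fun u : MoranInfWord n => take u k) :=
  continuous_pi fun i => continuous_apply (i : ℕ)

theorem MoranInfWord.measurable_take (k : ℕ) : Measurable (fun u : MoranInfWord n => take u k) :=
  measurable_pi_lambda _ fun i => measurable_pi_apply (i : ℕ)

theorem MoranInfWord.exists_take_eq (hn : ∀ k, 0 < n k) {k : ℕ} (v : MoranWord n k) :
    ∃ u : MoranInfWord n, take u k = v :=
  ⟨fun i => if h : i < k then v ⟨i, h⟩ else ⟨0, hn i⟩, funext fun i => by simp [take]⟩

variable {T : ∀ k, Fin (n k) → (EuclideanSpace ℝ (Fin d) →L[ℝ] EuclideanSpace ℝ (Fin d))}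
  {w : ∀ k, MoranWord n k → Fin (n k) → EuclideanSpace ℝ (Fin d)}
  {J : Set (EuclideanSpace ℝ (Fin d))}

theorem moranLinear_injective (hT : ∀ k j, Function.Injective (T k j)) (k : ℕ)
    (u : MoranWord n k) : Function.Injective (moranLinear T k u) := by
  induction k with
  | zero => exact Function.injective_id
  | succ k ih => exact (ih u.init).comp (hT k u.last)

theorem norm_moranLinear_le {η : ℝ} (hη : ∀ k j, ‖T k j‖ ≤ η) (k : ℕ) (u : MoranWord n k) :
    ‖moranLinear T k u‖ ≤ η ^ k := by
  induction k with
  | zero => simpa using! ContinuousLinearMap.norm_id_le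
  | succ k ih =>
    rw [pow_succ]
    exact (ContinuousLinearMap.opNorm_comp_le _ _).trans
      (mul_le_mul (ih u.init) (hη k u.last) (norm_nonneg _) ((norm_nonneg _).trans (ih u.init)))

theorem moranMap_eq_add (k : ℕ) (u : MoranWord n k) (x : EuclideanSpace ℝ (Fin d)) :
    moranMap T w k u x = moranMap T w k u 0 + moranLinear T k u x := by
  induction k generalizing x with
  | zero => simp [moranMap, moranLinear]
  | succ k ih =>
    change moranMap T w k u.init _ =
      moranMap T w k u.init _ + moranLinear T k u.init (T k u.last x)
    rw [ih, ih u.init (T k u.last 0 + _)]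
    simp only [map_add, map_zero]
    abel

/-- Every point of the Moran set lies in all the basic sets along some infinite word. -/
theorem exists_forall_mem_moranBasicSet (hn : ∀ k, 0 < n k) (hJ : IsSelfAffineMoran T w J)
    {x : EuclideanSpace ℝ (Fin d)} (hx : x ∈ moranSet T w J) :
    ∃ u : MoranInfWord n, ∀ k, x ∈ moranBasicSet T w J k (u.take k) := by
  have hclosed : ∀ k, IsClosed {u : MoranInfWord n |
      x ∈ moranBasicSet T w J (k + 1) (u.take (k + 1))} := fun k =>
    (isClosed_discrete {v | x ∈ moranBasicSet T w J (k + 1) v}).preimage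
      (MoranInfWord.continuous_take (k + 1))
  -- König's lemma as compactness: the words whose basic set of a given level contains `x` form
  -- closed sets, which decrease because the basic sets are nested.
  obtain ⟨u, hu⟩ := IsCompact.nonempty_iInter_of_sequence_nonempty_isCompact_isClosed
    (fun k => {u : MoranInfWord n | x ∈ moranBasicSet T w J (k + 1) (u.take (k + 1))})
    (fun k u hu => hJ.nested (k + 1) (u.take (k + 2)) hu)
    (fun k => by
      obtain ⟨v, hv⟩ := Set.mem_iUnion.1 (Set.mem_iInter.1 hx k)
      obtain ⟨u, rfl⟩ := MoranInfWord.exists_take_eq hn v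
      exact ⟨u, hv⟩)
    (hclosed 0).isCompact hclosed
  have hu' := fun k => Set.mem_iInter.1 hu k
  refine ⟨u, fun k => ?_⟩
  cases k with
  | zero => exact hJ.nested 0 (u.take 1) (hu' 0)
  | succ k => exact hu' k

theorem isCompact_moranBasicSet (hJ : IsCompact J) (k : ℕ) (u : MoranWord n k) :
    IsCompact (moranBasicSet T w J k u) := by
  refine hJ.image ?_
  rw [show moranMap T w k u = fun x => moranMap T w k u 0 + moranLinear T k u x from
    funext (moranMap_eq_add k u)]
  fun_prop

/-- A cover has at least one word and `φ^0 = 1`. This excludes `s = 0`, where cutting an ellipsoid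
at axis `⌈s⌉` makes no sense. -/
theorem netMeasure_zero_univ_ne_zero (hn : ∀ k, 0 < n k) : netMeasure T 0 Set.univ ≠ 0 := by
  intro h
  have h0 : netPremeasure T 0 0 Set.univ ≤ 0 := h ▸ le_iSup (fun k => netPremeasure T 0 k Set.univ) 0
  have h1 : 1 ≤ netPremeasure T 0 0 Set.univ := by
    refine le_iInf₂ fun A _ => le_iInf fun hcov => ?_
    obtain ⟨u, hu, -⟩ := Set.mem_iUnion₂.1 (hcov (Set.mem_univ (fun k => (⟨0, hn k⟩ : Fin (n k)))))
    refine le_trans ?_ (ENNReal.le_tsum (⟨u, hu⟩ : A))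
    simp [singularValueFunction_zero]
  exact absurd (h1.trans h0) (by simp)

theorem hausdorffMeasure_moranSet_eq_zero (hn : ∀ k, 0 < n k)
    (hT : ∀ k j, Function.Injective (T k j)) {η : ℝ} (hη0 : 0 ≤ η) (hη1 : η < 1)
    (hη : ∀ k j, ‖T k j‖ ≤ η) (hJ : IsSelfAffineMoran T w J) {s : ℝ≥0} (hs0 : s ≠ 0) (hsd : s ≤ d)
    (hs : netMeasure T s Set.univ = 0) :
    μH[s] (moranSet T w J) = 0 := by
  obtain ⟨R, hR, hJR⟩ : ∃ R : ℝ, 0 < R ∧ J ⊆ Metric.closedBall 0 R := by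
    obtain ⟨R, hR⟩ := hJ.isCompact.isBounded.subset_closedBall 0
    exact ⟨max R 1, by positivity, hR.trans (Metric.closedBall_subset_closedBall (le_max_left _ _))⟩
  have hA : ∀ k : ℕ, ∃ A : Set (Σ l : ℕ, MoranWord n l), (∀ u ∈ A, k ≤ u.1) ∧
      (Set.univ ⊆ ⋃ u ∈ A, u.2.cylinder) ∧
      ∑' u : A, ENNReal.ofReal (singularValueFunction s (moranLinear T u.1.1 u.1.2)) <
        ((k : ℝ≥0∞) + 1)⁻¹ := by
    intro k
    have h0 : netPremeasure T s k Set.univ ≤ 0 :=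
      hs ▸ le_iSup (fun k => netPremeasure T s k Set.univ) k
    have h1 : netPremeasure T s k Set.univ < ((k : ℝ≥0∞) + 1)⁻¹ :=
      h0.trans_lt (ENNReal.inv_pos.2 (by simp))
    simp only [netPremeasure, iInf_lt_iff] at h1
    obtain ⟨A, h1, h2, h3⟩ := h1
    exact ⟨A, h1, h2, h3⟩
  choose A hAlen hAcov hAsum using hA
  choose ι hfin c δ hδ0 hδT hcov hdiam hcard using fun u : Σ l : ℕ, MoranWord n l =>
    exists_cover_image_closedBall (moranLinear T u.1 u.2) (moranLinear_injective hT u.1 u.2) hs0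
      hsd hR
  set C : ℝ := 2 * R * √d with hC
  have hC0 : 0 ≤ C := by positivity
  have hiso : ∀ u i, Metric.ediam ((fun y => moranMap T w u.1 u.2 0 + y) '' c u i) ≤
      ENNReal.ofReal (C * δ u) := fun u i => by
    exact ((IsometryEquiv.addLeft (moranMap T w u.1 u.2 0)).isometry.ediam_image (c u i)).trans_le
      (hdiam u i)
  have hpt : ∀ u, ∑ i : ι u, Metric.ediam ((fun y => moranMap T w u.1 u.2 0 + y) '' c u i) ^ (s : ℝ)
      ≤ ENNReal.ofReal (C ^ (s : ℝ) * 2 ^ d) *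
        ENNReal.ofReal (singularValueFunction s (moranLinear T u.1 u.2)) := by
    intro u
    calc _ ≤ ∑ i : ι u, ENNReal.ofReal ((C * δ u) ^ (s : ℝ)) := by
          refine Finset.sum_le_sum fun i _ => ?_
          rw [← ENNReal.ofReal_rpow_of_nonneg (mul_nonneg hC0 (hδ0 u)) s.coe_nonneg]
          exact ENNReal.rpow_le_rpow (hiso u i) s.coe_nonneg
      _ = ENNReal.ofReal (C ^ (s : ℝ) * (Fintype.card (ι u) * δ u ^ (s : ℝ))) := by
          rw [Finset.sum_const, nsmul_eq_mul, Finset.card_univ,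
            Real.mul_rpow hC0 (hδ0 u), ← ENNReal.ofReal_natCast,
            ← ENNReal.ofReal_mul (by positivity)]
          congr 1
          ring
      _ ≤ _ := by
          rw [← ENNReal.ofReal_mul (by positivity), mul_assoc]
          refine ENNReal.ofReal_le_ofReal ?_
          exact mul_le_mul_of_nonneg_left (hcard u) (by positivity)
  -- The `k`-th cover uses words of length at least `k`, so its pieces have diameter at most `C * η
  -- ^ k`.
  have hle := Measure.hausdorffMeasure_le_liminf_tsum (β := ℕ) (ι := fun k => Σ u : A k, ι u.1)
    (s : ℝ) (moranSet T w J) (l := atTop) (fun k => ENNReal.ofReal (C * η ^ k))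
    (by
      have h := (tendsto_pow_atTop_nhds_zero_of_lt_one hη0 hη1).const_mul C
      simpa using ENNReal.tendsto_ofReal h)
    (fun k p => (fun y => moranMap T w p.1.1.1 p.1.1.2 0 + y) '' c p.1.1 p.2)
    (Eventually.of_forall fun k p => (hiso p.1.1 p.2).trans (by
      refine ENNReal.ofReal_le_ofReal (mul_le_mul_of_nonneg_left ?_ hC0)
      exact (hδT p.1.1).trans ((norm_moranLinear_le hη _ _).trans
        (pow_le_pow_of_le_one hη0 hη1.le (hAlen k _ p.1.2)))))
    (Eventually.of_forall fun k x hx => by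
      obtain ⟨u, hu⟩ := exists_forall_mem_moranBasicSet hn hJ hx
      obtain ⟨v, hv, huv⟩ := Set.mem_iUnion₂.1 (hAcov k (Set.mem_univ u))
      rw [MoranWord.mem_cylinder_iff] at huv
      obtain ⟨y, hy, hyx⟩ := hu v.1
      rw [huv, moranMap_eq_add] at hyx
      obtain ⟨i, hi⟩ := Set.mem_iUnion.1 (hcov v (Set.mem_image_of_mem _ (hJR hy)))
      exact Set.mem_iUnion.2 ⟨⟨⟨v, hv⟩, i⟩, _, hi, hyx⟩)
  refine le_antisymm (hle.trans ?_) bot_le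
  set K := ENNReal.ofReal (C ^ (s : ℝ) * 2 ^ d) with hK
  have hlim : Tendsto (fun k : ℕ => K * ((k : ℝ≥0∞) + 1)⁻¹) atTop (𝓝 0) := by
    have h1 : Tendsto (fun k : ℕ => ((k : ℝ≥0∞) + 1)⁻¹) atTop (𝓝 0) := by
      have := ENNReal.tendsto_inv_nat_nhds_zero.comp (tendsto_add_atTop_nat 1)
      refine this.congr fun k => ?_
      simp
    simpa using ENNReal.Tendsto.const_mul h1 (Or.inr ENNReal.ofReal_ne_top)
  rw [← hlim.liminf_eq]
  refine liminf_le_liminf (Eventually.of_forall fun k => ?_)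
  rw [ENNReal.tsum_sigma' (f := fun p : (Σ u : A k, ι u.1) =>
    Metric.ediam ((fun y => moranMap T w p.1.1.1 p.1.1.2 0 + y) '' c p.1.1 p.2) ^ (s : ℝ))]
  refine le_trans (ENNReal.tsum_le_tsum fun u => ?_)
    ((ENNReal.tsum_mul_left (a := K)).trans_le (mul_le_mul_right (hAsum k).le K))
  rw [tsum_fintype]
  exact hpt u.1

theorem dimH_moranSet_le (hn : ∀ k, 0 < n k) (hT : ∀ k j, Function.Injective (T k j)) {η : ℝ}
    (hη0 : 0 ≤ η) (hη1 : η < 1) (hη : ∀ k j, ‖T k j‖ ≤ η) (hJ : IsSelfAffineMoran T w J) :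
    dimH (moranSet T w J) ≤ criticalValue T := by
  refine le_iInf₂ fun s hs => ?_
  rcases le_or_gt s d with hsd | hsd
  · refine dimH_le_of_hausdorffMeasure_ne_top ?_
    have hs0 : s ≠ 0 := by
      rintro rfl
      exact netMeasure_zero_univ_ne_zero hn hs
    rw [hausdorffMeasure_moranSet_eq_zero hn hT hη0 hη1 hη hJ hs0 hsd hs]
    simp
  · calc dimH (moranSet T w J) ≤ dimH (Set.univ : Set (EuclideanSpace ℝ (Fin d))) :=
          dimH_mono (Set.subset_univ _)
      _ = d := by rw [Real.dimH_univ_eq_finrank]; simp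
      _ ≤ s := by exact_mod_cast hsd.le

end MoranMaps

/-! ### Measures on the word tree and Frostman's lemma -/

section TreeMeasure

variable {n : ℕ → ℕ}

/-- The word `v j`. -/
def MoranWord.snoc {k : ℕ} (v : MoranWord n k) (j : Fin (n k)) : MoranWord n (k + 1) :=
  fun i => if h : (i : ℕ) < k then v ⟨i, h⟩ else
    Fin.cast (by congr 1; omega) j

theorem MoranWord.init_snoc {k : ℕ} (v : MoranWord n k) (j : Fin (n k)) : (v.snoc j).init = v := by
  funext i
  simp [MoranWord.init, MoranWord.snoc]

theorem MoranWord.last_snoc {k : ℕ} (v : MoranWord n k) (j : Fin (n k)) : (v.snoc j).last = j := by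
  simp [MoranWord.last, MoranWord.snoc]

theorem MoranWord.ext_init_last {k : ℕ} {u v : MoranWord n (k + 1)} (h : u.init = v.init)
    (h' : u.last = v.last) : u = v := by
  funext i
  refine Fin.lastCases h' (fun j => congrFun h j) i

theorem MoranWord.snoc_init_last {k : ℕ} (v : MoranWord n (k + 1)) : v.init.snoc v.last = v :=
  MoranWord.ext_init_last (init_snoc _ _) (last_snoc _ _)

/-- The first `k` letters of the path from the root along which the letter `ω ⟨l, v⟩` follows the
word `v` of length `l`. -/
def treePrefix (ω : (p : Σ k, MoranWord n k) → Fin (n p.1)) : (k : ℕ) → MoranWord n k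
  | 0 => fun i => i.elim0
  | k + 1 => (treePrefix ω k).snoc (ω ⟨k, treePrefix ω k⟩)

/-- The infinite path from the root along which the letter `ω ⟨l, v⟩` follows the word `v`. -/
def treePath (ω : (p : Σ k, MoranWord n k) → Fin (n p.1)) : MoranInfWord n :=
  fun k => ω ⟨k, treePrefix ω k⟩

theorem take_treePath (ω : (p : Σ k, MoranWord n k) → Fin (n p.1)) (k : ℕ) :
    (treePath ω).take k = treePrefix ω k := by
  induction k with
  | zero => funext i; exact i.elim0
  | succ k ih =>
    refine MoranWord.ext_init_last ?_ ?_
    · rw [MoranInfWord.init_take, ih, treePrefix, MoranWord.init_snoc]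
    · rw [MoranInfWord.last_take, treePrefix, MoranWord.last_snoc, treePath]

theorem measurable_treePath :
    Measurable (treePath : ((p : Σ k, MoranWord n k) → Fin (n p.1)) → MoranInfWord n) := by
  have hpre : ∀ k, Measurable fun ω : (p : Σ k, MoranWord n k) → Fin (n p.1) => treePrefix ω k := by
    intro k
    induction k with
    | zero => exact measurable_const
    | succ k ih =>
      refine (measurable_of_countable fun p : MoranWord n k × (MoranWord n k → Fin (n k)) =>
        p.1.snoc (p.2 p.1)).comp (ih.prodMk (measurable_pi_lambda _ fun v =>
          measurable_pi_apply (⟨k, v⟩ : Σ k, MoranWord n k)))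
  refine measurable_pi_lambda _ fun k => ?_
  exact (measurable_of_countable fun p : MoranWord n k × (MoranWord n k → Fin (n k)) =>
    p.2 p.1).comp ((hpre k).prodMk (measurable_pi_lambda _ fun v =>
      measurable_pi_apply (⟨k, v⟩ : Σ k, MoranWord n k)))

theorem MoranWord.cylinder_eq_preimage {k : ℕ} (u : MoranWord n k) :
    u.cylinder = (fun v : MoranInfWord n => v.take k) ⁻¹' {u} :=
  Set.ext fun v => MoranWord.mem_cylinder_iff u v

theorem MoranWord.measurableSet_cylinder {k : ℕ} (u : MoranWord n k) :
    MeasurableSet u.cylinder := by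
  rw [u.cylinder_eq_preimage]
  exact MoranInfWord.measurable_take k (measurableSet_singleton _)

theorem mem_cylinder_succ_iff {k : ℕ} (u : MoranWord n (k + 1)) (v : MoranInfWord n) :
    v ∈ u.cylinder ↔ v ∈ u.init.cylinder ∧ v k = u.last := by
  rw [MoranWord.mem_cylinder_iff, MoranWord.mem_cylinder_iff]
  constructor
  · rintro rfl
    exact ⟨rfl, rfl⟩
  · rintro ⟨h, h'⟩
    exact MoranWord.ext_init_last h h'

theorem treePath_preimage_cylinder_succ {k : ℕ} (u : MoranWord n (k + 1)) :
    treePath ⁻¹' u.cylinder = treePath ⁻¹' u.init.cylinder ∩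
      {ω : (p : Σ k, MoranWord n k) → Fin (n p.1) | ω ⟨k, u.init⟩ = u.last} := by
  ext ω
  simp only [Set.mem_preimage, Set.mem_inter_iff, Set.mem_ofPred_eq, mem_cylinder_succ_iff u]
  refine and_congr_right fun h => ?_
  rw [MoranWord.mem_cylinder_iff, take_treePath] at h
  rw [treePath, h]

theorem pi_inter_eq_pi_insert_update {ι : Type*} [DecidableEq ι] {α : ι → Type*} (S : Finset ι)
    (t : (i : ι) → Set (α i)) {i : ι} (hi : i ∉ S) (a : Set (α i)) :
    Set.pi S t ∩ {ω | ω i ∈ a} = Set.pi (insert i S : Finset ι) (Function.update t i a) := by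
  ext ω
  simp only [Set.mem_inter_iff, Set.mem_pi, Finset.mem_coe, Set.mem_ofPred_eq, Finset.mem_insert,
    forall_eq_or_imp, Function.update_self]
  rw [and_comm]
  refine and_congr_right fun _ => forall₂_congr fun j hj => ?_
  rw [Function.update_of_ne (ne_of_mem_of_not_mem hj hi)]

/-- Probability vectors attached to the nodes of the word tree define a probability measure on the
infinite words. -/
theorem exists_measure_cylinder_succ (p : ∀ k, MoranWord n k → Measure (Fin (n k)))
    [∀ k v, IsProbabilityMeasure (p k v)] :
    ∃ μ : Measure (MoranInfWord n), IsProbabilityMeasure μ ∧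
      ∀ k (u : MoranWord n (k + 1)),
        μ u.cylinder = μ u.init.cylinder * p k u.init {u.last} := by
  classical
  -- A letter is drawn independently at every node, including nodes never visited, and the path from
  -- the root follows the draws.
  set P : Measure ((q : Σ k, MoranWord n k) → Fin (n q.1)) :=
    Measure.infinitePi fun q : Σ k, MoranWord n k => p q.1 q.2 with hP
  -- Passing through a word of length `k` depends only on draws at levels below `k`, hence is
  -- independent of the next draw.
  have key : ∀ k (u : MoranWord n k), ∃ (S : Finset (Σ k, MoranWord n k))
      (t : (q : Σ k, MoranWord n k) → Set (Fin (n q.1))), (∀ q ∈ S, q.1 < k) ∧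
      treePath ⁻¹' u.cylinder = Set.pi S t := by
    intro k
    induction k with
    | zero => exact fun u => ⟨∅, fun _ => ∅, by simp, by simp [MoranWord.cylinder]⟩
    | succ k ih =>
      intro u
      obtain ⟨S, t, hS, ht⟩ := ih u.init
      have hni : (⟨k, u.init⟩ : Σ k, MoranWord n k) ∉ S := fun h => lt_irrefl _ (hS _ h)
      refine ⟨insert ⟨k, u.init⟩ S, Function.update t ⟨k, u.init⟩ {u.last}, ?_, ?_⟩
      · intro q hq
        rcases Finset.mem_insert.1 hq with rfl | hq
        · exact Nat.lt_succ_self k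
        · exact (hS q hq).trans (Nat.lt_succ_self k)
      · rw [treePath_preimage_cylinder_succ, ht]
        exact pi_inter_eq_pi_insert_update S t hni {u.last}
  refine ⟨P.map treePath, Measure.isProbabilityMeasure_map measurable_treePath.aemeasurable,
    fun k u => ?_⟩
  rw [Measure.map_apply measurable_treePath u.measurableSet_cylinder,
    Measure.map_apply measurable_treePath u.init.measurableSet_cylinder]
  obtain ⟨S, t, hS, ht⟩ := key k u.init
  have hni : (⟨k, u.init⟩ : Σ k, MoranWord n k) ∉ S := fun h => lt_irrefl _ (hS _ h)
  have h1 : treePath ⁻¹' u.cylinder =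
      Set.pi (insert ⟨k, u.init⟩ S : Finset _) (Function.update t ⟨k, u.init⟩ {u.last}) := by
    rw [treePath_preimage_cylinder_succ, ht]
    exact pi_inter_eq_pi_insert_update S t hni {u.last}
  rw [h1, ht, hP, Measure.infinitePi_pi _ fun _ _ => MeasurableSet.of_discrete,
    Measure.infinitePi_pi _ fun _ _ => MeasurableSet.of_discrete, Finset.prod_insert hni,
    Function.update_self, mul_comm]
  congr 1
  refine Finset.prod_congr rfl fun q hq => ?_
  rw [Function.update_of_ne (ne_of_mem_of_not_mem hq hni)]

/-- A subadditive weight on the word tree dominates a measure on the infinite words. -/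
theorem exists_measure_cylinder_le (hn : ∀ k, 0 < n k) (g : ∀ k, MoranWord n k → ℝ≥0∞)
    (hfin : ∀ k u, g k u ≠ ∞)
    (hg : ∀ k (v : MoranWord n k), g k v ≤ ∑ j, g (k + 1) (v.snoc j)) (v₀ : MoranWord n 0) :
    ∃ μ : Measure (MoranInfWord n), IsProbabilityMeasure μ ∧
      ∀ k (u : MoranWord n k), g 0 v₀ * μ u.cylinder ≤ g k u := by
  -- The mass at `v` is split in proportion to the weights of its children; subadditivity makes each
  -- share small enough. If all these weights vanish, so does `g k v`, and any distribution serves.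
  have hp : ∀ k (v : MoranWord n k), ∃ p : PMF (Fin (n k)),
      ∀ j, g k v * p j ≤ g (k + 1) (v.snoc j) := by
    intro k v
    by_cases h0 : ∑ j, g (k + 1) (v.snoc j) = 0
    · have hv : g k v = 0 := le_antisymm ((hg k v).trans h0.le) bot_le
      exact ⟨PMF.pure ⟨0, hn k⟩, fun j => by simp [hv]⟩
    · have htop : ∑ j, g (k + 1) (v.snoc j) ≠ ∞ := ENNReal.sum_ne_top.2 fun j _ => hfin _ _
      refine ⟨PMF.normalize (fun j => g (k + 1) (v.snoc j)) (by rwa [tsum_fintype])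
        (by rwa [tsum_fintype]), fun j => ?_⟩
      rw [PMF.normalize_apply, tsum_fintype, mul_left_comm]
      refine (mul_le_mul_right (mul_le_mul_left (hg k v) _) _).trans ?_
      rw [ENNReal.mul_inv_cancel h0 htop, mul_one]
  choose p hp using hp
  obtain ⟨μ, hμ, hμs⟩ := exists_measure_cylinder_succ fun k v => (p k v).toMeasure
  refine ⟨μ, hμ, fun k => ?_⟩
  induction k with
  | zero =>
    intro u
    rw [Subsingleton.elim u v₀]
    exact (mul_le_mul_right prob_le_one _).trans (mul_one _).le
  | succ k ih =>
    intro u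
    rw [hμs, ← mul_assoc, PMF.toMeasure_apply_singleton _ _ (measurableSet_singleton _)]
    refine (mul_le_mul_left (ih u.init) _).trans ?_
    have := hp k u.init u.last
    rwa [u.snoc_init_last] at this

variable {d : ℕ} {T : ∀ k, Fin (n k) → (EuclideanSpace ℝ (Fin d) →L[ℝ] EuclideanSpace ℝ (Fin d))}

theorem netPremeasure_mono (s : ℝ≥0) (k : ℕ) {G H : Set (MoranInfWord n)} (h : G ⊆ H) :
    netPremeasure T s k G ≤ netPremeasure T s k H :=
  le_iInf₂ fun A hA => le_iInf fun hc => iInf₂_le_of_le A hA (iInf_le _ (h.trans hc))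

theorem netPremeasure_union_le (s : ℝ≥0) (k : ℕ) (G H : Set (MoranInfWord n)) :
    netPremeasure T s k (G ∪ H) ≤ netPremeasure T s k G + netPremeasure T s k H := by
  simp only [netPremeasure, ENNReal.iInf_add, ENNReal.add_iInf]
  refine le_iInf₂ fun B hB => le_iInf fun hBH => le_iInf₂ fun A hA => le_iInf fun hAG => ?_
  refine iInf₂_le_of_le (A ∪ B) (fun u hu => hu.elim (hA u) (hB u)) (iInf_le_of_le ?_ ?_)
  · rw [Set.biUnion_union]
    exact Set.union_subset_union hAG hBH
  · have h := ENNReal.tsum_union_le (fun u : Σ l, MoranWord n l =>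
      ENNReal.ofReal (singularValueFunction s (moranLinear T u.1 u.2))) A B
    exact h

theorem netPremeasure_biUnion_le (s : ℝ≥0) (k : ℕ) {ι : Type*} (S : Finset ι)
    (G : ι → Set (MoranInfWord n)) :
    netPremeasure T s k (⋃ i ∈ S, G i) ≤ ∑ i ∈ S, netPremeasure T s k (G i) := by
  classical
  induction S using Finset.induction_on with
  | empty =>
    refine iInf₂_le_of_le ∅ (by simp) (iInf_le_of_le (by simp) (by simp))
  | insert i S hi ih =>
    rw [Finset.sum_insert hi, Finset.set_biUnion_insert]
    exact (netPremeasure_union_le s k _ _).trans (add_le_add_right ih _)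

theorem netPremeasure_cylinder_le (s : ℝ≥0) {k : ℕ} (u : MoranWord n k) :
    netPremeasure T s 0 u.cylinder ≤ ENNReal.ofReal (singularValueFunction s (moranLinear T k u)) := by
  refine iInf₂_le_of_le {⟨k, u⟩} (by simp) (iInf_le_of_le (by simp) ?_)
  rw [tsum_singleton (⟨k, u⟩ : Σ k, MoranWord n k)
    (fun u => ENNReal.ofReal (singularValueFunction s (moranLinear T u.1 u.2)))]

/-- A cover either consists of words of length at least `k`, or contains one of the finitely many
shorter words, on which `φ^s` has a positive minimum. -/
theorem netPremeasure_zero_ne_zero (hT : ∀ k j, Function.Injective (T k j)) {s : ℝ≥0}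
    (hs : netMeasure T s Set.univ ≠ 0) :
    netPremeasure T s 0 (Set.univ : Set (MoranInfWord n)) ≠ 0 := by
  obtain ⟨k, hk⟩ : ∃ k, netPremeasure T s k (Set.univ : Set (MoranInfWord n)) ≠ 0 := by
    by_contra! h
    exact hs (by simp [netMeasure, h])
  have hfin : Finite (Σ l : Fin k, MoranWord n l) := inferInstance
  obtain ⟨ε, hε0, hε⟩ : ∃ ε : ℝ≥0∞, ε ≠ 0 ∧ ∀ q : Σ l : Fin k, MoranWord n l,
      ε ≤ ENNReal.ofReal (singularValueFunction s (moranLinear T q.1 q.2)) := by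
    rcases isEmpty_or_nonempty (Σ l : Fin k, MoranWord n l) with h | h
    · exact ⟨1, one_ne_zero, fun q => h.elim q⟩
    · obtain ⟨q, hq⟩ := Finite.exists_min fun q : Σ l : Fin k, MoranWord n l =>
        ENNReal.ofReal (singularValueFunction s (moranLinear T q.1 q.2))
      exact ⟨_, (ENNReal.ofReal_pos.2 (singularValueFunction_pos _
        (moranLinear_injective hT _ _) s)).ne', hq⟩
  have hle : min ε (netPremeasure T s k (Set.univ : Set (MoranInfWord n))) ≤
      netPremeasure T s 0 (Set.univ : Set (MoranInfWord n)) := by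
    refine le_iInf₂ fun A _ => le_iInf fun hc => ?_
    by_cases hA : ∀ u ∈ A, k ≤ u.1
    · exact (min_le_right _ _).trans (iInf₂_le_of_le A hA (iInf_le _ hc))
    · push Not at hA
      obtain ⟨u, hu, huk⟩ := hA
      exact (min_le_left _ _).trans ((hε ⟨⟨u.1, huk⟩, u.2⟩).trans
        (ENNReal.le_tsum (f := fun u : A => ENNReal.ofReal
          (singularValueFunction s (moranLinear T u.1.1 u.1.2))) ⟨u, hu⟩))
  intro h
  rw [h, nonpos_iff_eq_zero] at hle
  rcases min_choice ε (netPremeasure T s k (Set.univ : Set (MoranInfWord n))) with h' | h'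
  · exact hε0 (h' ▸ hle)
  · exact hk (h' ▸ hle)

/-- Frostman's lemma for the net measures. -/
theorem exists_measure_cylinder_le_singularValueFunction (hn : ∀ k, 0 < n k)
    (hT : ∀ k j, Function.Injective (T k j)) {s : ℝ≥0} (hs : netMeasure T s Set.univ ≠ 0) :
    ∃ (μ : Measure (MoranInfWord n)) (C : ℝ≥0∞), IsProbabilityMeasure μ ∧ C ≠ ∞ ∧
      ∀ k (u : MoranWord n k),
        μ u.cylinder ≤ C * ENNReal.ofReal (singularValueFunction s (moranLinear T k u)) := by
  have v₀ : MoranWord n 0 := fun i => i.elim0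
  have hfin : ∀ k (u : MoranWord n k), netPremeasure T s 0 u.cylinder ≠ ∞ := fun k u =>
    ((netPremeasure_cylinder_le s u).trans_lt ENNReal.ofReal_lt_top).ne
  -- The weight of `u` is the premeasure of its cylinder with no restriction on length: it is
  -- subadditive, and the cover by the single word `u` bounds it by `φ^s(T_u)`.
  obtain ⟨μ, hμ, hle⟩ := exists_measure_cylinder_le hn
    (fun k u => netPremeasure T s 0 u.cylinder) hfin
    (fun k v => by
      refine le_trans (netPremeasure_mono s 0 ?_)
        (netPremeasure_biUnion_le s 0 Finset.univ fun j => (v.snoc j).cylinder)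
      intro x hx
      simp only [Finset.mem_univ, Set.iUnion_true, Set.mem_iUnion]
      refine ⟨x k, (mem_cylinder_succ_iff _ _).2 ⟨?_, ?_⟩⟩
      · rwa [MoranWord.init_snoc]
      · rw [MoranWord.last_snoc]) v₀
  have huniv : v₀.cylinder = Set.univ := Set.eq_univ_of_forall fun x i => i.elim0
  simp only [huniv] at hle
  have h0 := netPremeasure_zero_ne_zero hT hs
  have htop : netPremeasure T s 0 (Set.univ : Set (MoranInfWord n)) ≠ ∞ := huniv ▸ hfin 0 v₀
  refine ⟨μ, (netPremeasure T s 0 (Set.univ : Set (MoranInfWord n)))⁻¹, hμ,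
    ENNReal.inv_ne_top.2 h0, fun k u => ?_⟩
  calc μ u.cylinder = (netPremeasure T s 0 (Set.univ : Set (MoranInfWord n)))⁻¹ *
        (netPremeasure T s 0 (Set.univ : Set (MoranInfWord n)) * μ u.cylinder) := by
        rw [← mul_assoc, ENNReal.inv_mul_cancel h0 htop, one_mul]
    _ ≤ _ := mul_le_mul_right ((hle k u).trans (netPremeasure_cylinder_le s u)) _

end TreeMeasure

/-! ### Series of products of contractions -/

section OperatorSeries

variable {E : Type*} [NormedAddCommGroup E] [NormedSpace ℝ E] {S : ℕ → E →L[ℝ] E} {c : ℕ → E}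
  {η M : ℝ}

/-- The product `S 0 ∘ ⋯ ∘ S (l - 1)`. -/
def opProd (S : ℕ → E →L[ℝ] E) : ℕ → E →L[ℝ] E
  | 0 => ContinuousLinearMap.id ℝ E
  | l + 1 => (opProd S l).comp (S l)

/-- The series `∑ S 0 ∘ ⋯ ∘ S (l - 1) (c l)`. -/
def opSeries (S : ℕ → E →L[ℝ] E) (c : ℕ → E) : E := ∑' l, opProd S l (c l)

theorem norm_opProd_le (hS : ∀ l, ‖S l‖ ≤ η) (l : ℕ) : ‖opProd S l‖ ≤ η ^ l := by
  induction l with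
  | zero => simpa using! ContinuousLinearMap.norm_id_le
  | succ l ih =>
    rw [pow_succ]
    exact (ContinuousLinearMap.opNorm_comp_le _ _).trans
      (mul_le_mul ih (hS l) (norm_nonneg _) ((norm_nonneg _).trans ih))

theorem opProd_add (S : ℕ → E →L[ℝ] E) (k l : ℕ) (x : E) :
    opProd S (l + k) x = opProd S k (opProd (fun i => S (i + k)) l x) := by
  induction l generalizing x with
  | zero => simp [opProd]
  | succ l ih =>
    rw [Nat.add_right_comm]
    exact ih (S (l + k) x)

theorem norm_opProd_apply_le (hη0 : 0 ≤ η) (hS : ∀ l, ‖S l‖ ≤ η) (hc : ∀ l, ‖c l‖ ≤ M) (l : ℕ) :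
    ‖opProd S l (c l)‖ ≤ η ^ l * M :=
  ((opProd S l).le_opNorm _).trans
    (mul_le_mul (norm_opProd_le hS l) (hc l) (norm_nonneg _) (pow_nonneg hη0 l))

theorem hasSum_geometric_mul (hη0 : 0 ≤ η) (hη1 : η < 1) (M : ℝ) :
    HasSum (fun l : ℕ => η ^ l * M) ((1 - η)⁻¹ * M) :=
  (hasSum_geometric_of_lt_one hη0 hη1).mul_right M

theorem norm_opSeries_le (hη0 : 0 ≤ η) (hη1 : η < 1) (hS : ∀ l, ‖S l‖ ≤ η)
    (hc : ∀ l, ‖c l‖ ≤ M) : ‖opSeries S c‖ ≤ (1 - η)⁻¹ * M :=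
  tsum_of_norm_bounded (hasSum_geometric_mul hη0 hη1 M) (norm_opProd_apply_le hη0 hS hc)

variable [CompleteSpace E]

theorem summable_opProd (hη0 : 0 ≤ η) (hη1 : η < 1) (hS : ∀ l, ‖S l‖ ≤ η) (hc : ∀ l, ‖c l‖ ≤ M) :
    Summable fun l => opProd S l (c l) :=
  Summable.of_norm_bounded (hasSum_geometric_mul hη0 hη1 M).summable
    (norm_opProd_apply_le hη0 hS hc)

theorem opSeries_eq_sum_add (hη0 : 0 ≤ η) (hη1 : η < 1) (hS : ∀ l, ‖S l‖ ≤ η)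
    (hc : ∀ l, ‖c l‖ ≤ M) (k : ℕ) :
    opSeries S c = ∑ l ∈ Finset.range k, opProd S l (c l) +
      opProd S k (opSeries (fun i => S (i + k)) fun i => c (i + k)) := by
  rw [opSeries, ← (summable_opProd hη0 hη1 hS hc).sum_add_tsum_nat_add k, opSeries,
    ContinuousLinearMap.map_tsum _
      (summable_opProd hη0 hη1 (fun l => hS (l + k)) fun l => hc (l + k))]
  simp only [opProd_add]

theorem opSeries_sub (hη0 : 0 ≤ η) (hη1 : η < 1) (hS : ∀ l, ‖S l‖ ≤ η)
    (hc : ∀ l, ‖c l‖ ≤ M) {c' : ℕ → E} {M' : ℝ} (hc' : ∀ l, ‖c' l‖ ≤ M') :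
    opSeries S (fun l => c l - c' l) = opSeries S c - opSeries S c' := by
  simp only [opSeries, map_sub]
  exact (summable_opProd hη0 hη1 hS hc).tsum_sub (summable_opProd hη0 hη1 hS hc')

/-- The difference of two series is close to the difference of their leading terms. -/
theorem norm_opSeries_sub_opSeries_sub_le (hη0 : 0 ≤ η) (hη1 : η < 1) {S' : ℕ → E →L[ℝ] E}
    (hS : ∀ l, ‖S l‖ ≤ η) (hS' : ∀ l, ‖S' l‖ ≤ η) {c' : ℕ → E} (hc : ∀ l, ‖c l‖ ≤ M)
    (hc' : ∀ l, ‖c' l‖ ≤ M) :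
    ‖opSeries S c - opSeries S' c' - (c 0 - c' 0)‖ ≤ 2 * (η * ((1 - η)⁻¹ * M)) := by
  have key : ∀ {S : ℕ → E →L[ℝ] E} {c : ℕ → E}, (∀ l, ‖S l‖ ≤ η) → (∀ l, ‖c l‖ ≤ M) →
      ‖opSeries S c - c 0‖ ≤ η * ((1 - η)⁻¹ * M) := by
    intro S c hS hc
    rw [opSeries_eq_sum_add hη0 hη1 hS hc 1]
    simp only [Finset.range_one, Finset.sum_singleton, opProd, ContinuousLinearMap.id_comp,
      ContinuousLinearMap.id_apply, add_sub_cancel_left]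
    exact ((S 0).le_opNorm _).trans (mul_le_mul (hS 0)
      (norm_opSeries_le hη0 hη1 (fun l => hS (l + 1)) fun l => hc (l + 1)) (norm_nonneg _) hη0)
  have h1 := key hS hc
  have h2 := key hS' hc'
  calc _ = ‖(opSeries S c - c 0) - (opSeries S' c' - c' 0)‖ := by congr 1; abel
    _ ≤ _ := (norm_sub_le _ _).trans (by linarith)

end OperatorSeries

/-! ### The coding map and the existence of an admissible `J` -/

section CodingMap

variable {d : ℕ} {n : ℕ → ℕ}
  {T : ∀ k, Fin (n k) → (EuclideanSpace ℝ (Fin d) →L[ℝ] EuclideanSpace ℝ (Fin d))}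
  {w : ∀ k, MoranWord n k → Fin (n k) → EuclideanSpace ℝ (Fin d)}
  {J : Set (EuclideanSpace ℝ (Fin d))} {η M : ℝ}

/-- The point of the Moran set coded by an infinite word. -/
def codingMap (T : ∀ k, Fin (n k) → (EuclideanSpace ℝ (Fin d) →L[ℝ] EuclideanSpace ℝ (Fin d)))
    (w : ∀ k, MoranWord n k → Fin (n k) → EuclideanSpace ℝ (Fin d)) (u : MoranInfWord n) :
    EuclideanSpace ℝ (Fin d) :=
  opSeries (fun l => T l (u l)) fun l => w l (u.take l) (u l)

theorem moranLinear_take (u : MoranInfWord n) (k : ℕ) :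
    moranLinear T k (u.take k) = opProd (fun l => T l (u l)) k := by
  induction k with
  | zero => rfl
  | succ k ih => rw [moranLinear, opProd, MoranInfWord.init_take, MoranInfWord.last_take, ih]

theorem moranMap_take (u : MoranInfWord n) (k : ℕ) (x : EuclideanSpace ℝ (Fin d)) :
    moranMap T w k (u.take k) x =
      ∑ l ∈ Finset.range k, opProd (fun l => T l (u l)) l (w l (u.take l) (u l)) +
        opProd (fun l => T l (u l)) k x := by
  induction k generalizing x with
  | zero => simp [moranMap, opProd]
  | succ k ih =>
    rw [Finset.sum_range_succ, moranMap, MoranInfWord.init_take, MoranInfWord.last_take]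
    beta_reduce
    rw [ih, opProd, map_add, ContinuousLinearMap.comp_apply]
    abel

theorem tendsto_moranMap_take (hη0 : 0 ≤ η) (hη1 : η < 1) (hη : ∀ k j, ‖T k j‖ ≤ η)
    (hw : ∀ k u j, ‖w k u j‖ ≤ M) (u : MoranInfWord n) (x : EuclideanSpace ℝ (Fin d)) :
    Tendsto (fun k => moranMap T w k (u.take k) x) atTop (𝓝 (codingMap T w u)) := by
  simp only [moranMap_take]
  have h1 := (summable_opProd hη0 hη1 (fun l => hη l (u l))
    fun l => hw l (u.take l) (u l)).hasSum.tendsto_sum_nat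
  have h2 : Tendsto (fun k => opProd (fun l => T l (u l)) k x) atTop (𝓝 0) := by
    refine squeeze_zero_norm (fun k => (norm_opProd_apply_le (c := fun _ => x) hη0
      (fun l => hη l (u l)) (fun _ => le_rfl) k)) ?_
    simpa using (tendsto_pow_atTop_nhds_zero_of_lt_one hη0 hη1).mul_const ‖x‖
  simpa using! h1.add h2

theorem codingMap_mem_moranSet (hη0 : 0 ≤ η) (hη1 : η < 1) (hη : ∀ k j, ‖T k j‖ ≤ η)
    (hw : ∀ k u j, ‖w k u j‖ ≤ M) (hJ : IsSelfAffineMoran T w J) (u : MoranInfWord n) :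
    codingMap T w u ∈ moranSet T w J := by
  obtain ⟨x, hx⟩ := hJ.interior_nonempty.mono interior_subset
  refine Set.mem_iInter.2 fun k => Set.mem_iUnion.2 ⟨u.take (k + 1), ?_⟩
  have hanti : Antitone fun k => moranBasicSet T w J k (u.take k) :=
    antitone_nat_of_succ_le fun k => hJ.nested k (u.take (k + 1))
  refine (isCompact_moranBasicSet hJ.isCompact (k + 1) _).isClosed.mem_of_tendsto
    (tendsto_moranMap_take hη0 hη1 hη hw u x) ?_
  filter_upwards [eventually_ge_atTop (k + 1)] with m hm
  exact hanti hm (Set.mem_image_of_mem _ hx)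

theorem exists_isSelfAffineMoran (hn : ∀ k, 0 < n k) (hη0 : 0 ≤ η) (hη1 : η < 1)
    (hη : ∀ k j, ‖T k j‖ ≤ η)
    (hw : ∀ k u j, ‖w k u j‖ ≤ M) : ∃ J, IsSelfAffineMoran T w J := by
  have hM : 0 ≤ M := (norm_nonneg _).trans (hw 0 (fun i => i.elim0) ⟨0, hn 0⟩)
  -- Any `R ≥ M / (1 - η)` makes the ball invariant; the extra 1 keeps `R` positive when `M = 0`.
  set R : ℝ := (M + 1) / (1 - η) with hR
  have hR0 : 0 < R := div_pos (by linarith) (by linarith)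
  have hRM : η * R + M ≤ R := by
    have : R * (1 - η) = M + 1 := div_mul_cancel₀ _ (by linarith)
    linarith
  refine ⟨Metric.closedBall 0 R, isCompact_closedBall 0 R, ?_, ?_, ?_⟩
  · exact ⟨0, Metric.ball_subset_interior_closedBall (Metric.mem_ball_self hR0)⟩
  · rintro k u _ ⟨x, hx, rfl⟩
    refine ⟨T k u.last x + w k u.init u.last, ?_, rfl⟩
    rw [mem_closedBall_zero_iff] at hx ⊢
    refine (norm_add_le _ _).trans ((add_le_add ?_ (hw _ _ _)).trans hRM)
    exact ((T k u.last).le_opNorm x).trans (mul_le_mul (hη _ _) hx (norm_nonneg _) hη0)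
  · have hbound : ∀ k (u : MoranWord n k),
        Metric.diam (moranBasicSet T w (Metric.closedBall 0 R) k u) ≤ η ^ k * (2 * R) := by
      intro k u
      refine Metric.diam_le_of_forall_dist_le (by positivity) ?_
      rintro _ ⟨x, hx, rfl⟩ _ ⟨y, hy, rfl⟩
      rw [moranMap_eq_add k u x, moranMap_eq_add k u y, dist_add_left, dist_eq_norm, ← map_sub]
      refine ((moranLinear T k u).le_opNorm _).trans
        (mul_le_mul (norm_moranLinear_le hη k u) ?_ (norm_nonneg _) (by positivity))
      rw [mem_closedBall_zero_iff] at hx hy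
      exact (norm_sub_le _ _).trans (by linarith)
    have hne : ∀ k, Nonempty (MoranWord n k) := fun k => ⟨fun i => ⟨0, hn i⟩⟩
    refine squeeze_zero (fun k => Real.iSup_nonneg fun u => Metric.diam_nonneg)
      (fun k => ciSup_le (hbound k)) ?_
    simpa using (tendsto_pow_atTop_nhds_zero_of_lt_one hη0 hη1).mul_const (2 * R)

end CodingMap

/-! ### Fubini over translates, and volume under expanding maps -/

section Averaging

/-- A set is small if its translates along `ι` meet a fixed set in small sets. -/
theorem measure_mul_measure_le_of_translates {E V : Type*} [MeasurableSpace E] [MeasurableSpace V]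
    [AddGroup V] [MeasurableAdd₂ V] {ν : Measure E} [SFinite ν] {μ : Measure V} [SFinite μ]
    [μ.IsAddRightInvariant] {ι : E → V} (hι : Measurable ι) {B : Set E} (hB : MeasurableSet B)
    {S D : Set V} (hS : MeasurableSet S) (hD : MeasurableSet D) {K : ℝ≥0∞}
    (hK : ∀ a, ν {y | y ∈ B ∧ a + ι y ∈ S} ≤ K) (hSD : ∀ a, ∀ y ∈ B, a + ι y ∈ S → a ∈ D) :
    ν B * μ S ≤ K * μ D := by
  -- Fubini on `Q`: for fixed `y ∈ B` the slice is a translate of `S`; for fixed `a` it has measure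
  -- at most `K`, and is empty unless `a ∈ D`.
  set Q : Set (E × V) := {p | p.1 ∈ B ∧ p.2 + ι p.1 ∈ S} with hQ
  have hQm : MeasurableSet Q :=
    (measurable_fst hB).inter ((measurable_snd.add (hι.comp measurable_fst)) hS)
  have h1 : (ν.prod μ) Q = ν B * μ S := by
    rw [Measure.prod_apply hQm]
    have : ∀ y, μ (Prod.mk y ⁻¹' Q) = B.indicator (fun _ => μ S) y := by
      intro y
      by_cases hy : y ∈ B
      · rw [Set.indicator_of_mem hy, ← measure_preimage_add_right μ (ι y) S]
        congr 1
        ext a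
        simp [hQ, hy]
      · rw [Set.indicator_of_notMem hy]
        have : Prod.mk y ⁻¹' Q = ∅ := by
          ext a
          simp [hQ, hy]
        rw [this, measure_empty]
    simp_rw [this]
    rw [lintegral_indicator_const hB, mul_comm]
  have h2 : (ν.prod μ) Q ≤ K * μ D := by
    rw [Measure.prod_apply_symm hQm, ← lintegral_indicator_const hD]
    refine lintegral_mono fun a => ?_
    by_cases ha : a ∈ D
    · rw [Set.indicator_of_mem ha]
      exact hK a
    · rw [Set.indicator_of_notMem ha]
      have : (fun y => (y, a)) ⁻¹' Q = ∅ := by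
        ext y
        simp only [hQ, Set.mem_preimage, Set.mem_empty_iff_false, iff_false]
        exact fun h => ha (hSD a y h.1 h.2)
      rw [this, measure_empty]
  exact h1 ▸ h2

/-- Volume is a multiple of `μH[d]`, whose behaviour under antilipschitz maps is explicit. -/
theorem AntilipschitzWith.volume_preimage_le {d : ℕ}
    {f : EuclideanSpace ℝ (Fin d) → EuclideanSpace ℝ (Fin d)} {K : ℝ≥0} (hf : AntilipschitzWith K f)
    (s : Set (EuclideanSpace ℝ (Fin d))) : volume (f ⁻¹' s) ≤ (K : ℝ≥0∞) ^ (d : ℝ) * volume s := by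
  have hH : (μH[(d : ℝ)] : Measure (EuclideanSpace ℝ (Fin d))).IsAddHaarMeasure := by
    simpa using isAddHaarMeasure_hausdorffMeasure (E := EuclideanSpace ℝ (Fin d))
  rw [Measure.isAddLeftInvariant_eq_smul (volume : Measure (EuclideanSpace ℝ (Fin d))) μH[(d : ℝ)],
    Measure.smul_apply, Measure.smul_apply, ENNReal.smul_def, ENNReal.smul_def, smul_eq_mul,
    smul_eq_mul, mul_left_comm]
  exact mul_le_mul_right (hf.hausdorffMeasure_preimage_le (by simp) s) _

end Averaging

/-! ### Transversality in the parameter `a` -/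

section Transversality

variable {d : ℕ} {n : ℕ → ℕ}
  {T : ∀ k, Fin (n k) → (EuclideanSpace ℝ (Fin d) →L[ℝ] EuclideanSpace ℝ (Fin d))}
  {η : ℝ} {τ : ℕ} {γ : ∀ k, MoranWord n k → Fin (n k) → Fin τ}

/-- The translations of the Moran maps when the vectors `a` are distributed by `γ`. -/
abbrev translations (γ : ∀ k, MoranWord n k → Fin (n k) → Fin τ)
    (a : Fin τ → EuclideanSpace ℝ (Fin d)) :
    ∀ k, MoranWord n k → Fin (n k) → EuclideanSpace ℝ (Fin d) :=
  fun k u j => a (γ k u j)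

theorem measurable_codingMap (hη0 : 0 ≤ η) (hη1 : η < 1) (hη : ∀ k j, ‖T k j‖ ≤ η) :
    Measurable fun p : (Fin τ → EuclideanSpace ℝ (Fin d)) × MoranInfWord n =>
      codingMap T (translations γ p.1) p.2 := by
  have hmap : ∀ k (v : MoranWord n k),
      Measurable fun q : (Fin τ → EuclideanSpace ℝ (Fin d)) × EuclideanSpace ℝ (Fin d) =>
        moranMap T (translations γ q.1) k v q.2 := by
    intro k
    induction k with
    | zero => exact fun _ => measurable_snd
    | succ k ih =>
      intro v
      refine (ih v.init).comp (measurable_fst.prodMk (((T k v.last).measurable.comp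
        measurable_snd).add ((measurable_pi_apply (γ k v.init v.last)).comp
          measurable_fst)))
  refine measurable_of_tendsto_metrizable (f := fun k p =>
    moranMap T (translations γ p.1) k (p.2.take k) 0) (fun k => ?_) ?_
  · exact (measurable_from_prod_countable_left (f := fun q :
      (Fin τ → EuclideanSpace ℝ (Fin d)) × MoranWord n k =>
        moranMap T (translations γ q.1) k q.2 0) fun v =>
          (hmap k v).comp (measurable_id.prodMk measurable_const)).comp
      (measurable_fst.prodMk ((MoranInfWord.measurable_take k).comp measurable_snd))
  · rw [tendsto_pi_nhds]
    exact fun p => tendsto_moranMap_take hη0 hη1 hη (fun _ _ _ => norm_le_pi_norm p.1 _) p.2 0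

/-- Transversality: the set of parameters for which two codes give close points is small. -/
theorem exists_volume_norm_codingMap_sub_le (hη0 : 0 ≤ η) (hη2 : η < 1 / 2)
    (hη : ∀ k j, ‖T k j‖ ≤ η) (hT : ∀ k j, Function.Injective (T k j))
    (hγ : ∀ k u, Function.Injective (γ k u)) (ρ : ℝ) :
    ∃ C : ℝ≥0∞, C ≠ ∞ ∧ ∀ (t : ℝ≥0) (r : ℝ) (u v : MoranInfWord n) (k : ℕ), t ≤ d → 0 < r →
      u.take k = v.take k → u k ≠ v k →
      volume {a : Fin τ → EuclideanSpace ℝ (Fin d) | ‖a‖ ≤ ρ ∧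
        ‖codingMap T (translations γ a) u - codingMap T (translations γ a) v‖ ≤ r} ≤
      C * ENNReal.ofReal
        (r ^ (t : ℝ) / singularValueFunction t (moranLinear T k (u.take k))) := by
  have hη1 : η < 1 := by linarith
  -- `δ` bounds the effect of one tail beyond its leading term. The condition `δ < 1` is equivalent
  -- to `η < 1 / 2`.
  set δ : ℝ := η * (1 - η)⁻¹ with hδ
  have hδ1 : δ < 1 := by
    rw [hδ, ← div_eq_mul_inv, div_lt_one (by linarith)]
    linarith
  set K : ℝ≥0 := ⟨(2 - 2 * δ)⁻¹, inv_nonneg.2 (by linarith)⟩ with hK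
  set B : Set (EuclideanSpace ℝ (Fin d)) := Metric.closedBall 0 1 with hB
  set D : Set (Fin τ → EuclideanSpace ℝ (Fin d)) := Metric.closedBall 0 (ρ + 1) with hD
  have hB0 : volume B ≠ 0 := (Metric.measure_closedBall_pos _ _ one_pos).ne'
  have hBtop : volume B ≠ ∞ := measure_closedBall_lt_top.ne
  have hDtop : volume D ≠ ∞ := measure_closedBall_lt_top.ne
  refine ⟨(volume B)⁻¹ * ((K : ℝ≥0∞) ^ (d : ℝ) * ENNReal.ofReal ((2 * 4) ^ d) * volume D), ?_, ?_⟩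
  · exact ENNReal.mul_ne_top (ENNReal.inv_ne_top.2 hB0) (ENNReal.mul_ne_top (ENNReal.mul_ne_top
      (ENNReal.rpow_ne_top_of_nonneg (by simp) ENNReal.coe_ne_top) ENNReal.ofReal_ne_top) hDtop)
  intro t r u v k ht hr huv hne
  set L := moranLinear T k (u.take k) with hL
  set S : Set (Fin τ → EuclideanSpace ℝ (Fin d)) := {a | ‖a‖ ≤ ρ ∧
    ‖codingMap T (translations γ a) u - codingMap T (translations γ a) v‖ ≤ r} with hS
  -- the tails of the two series beyond the common prefix
  set G : (Fin τ → EuclideanSpace ℝ (Fin d)) → EuclideanSpace ℝ (Fin d) := fun a =>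
    opSeries (fun l => T (l + k) (u (l + k)))
        (fun l => translations γ a (l + k) (u.take (l + k)) (u (l + k))) -
      opSeries (fun l => T (l + k) (v (l + k)))
        (fun l => translations γ a (l + k) (v.take (l + k)) (v (l + k))) with hG
  have hdiff : ∀ a, codingMap T (translations γ a) u - codingMap T (translations γ a) v =
      L (G a) := by
    intro a
    have hlt : ∀ l < k, u l = v l := fun l hl => congrFun huv ⟨l, hl⟩
    have htake : ∀ l < k, u.take l = v.take l := fun l hl =>
      funext fun i => hlt i (i.2.trans hl)
    have hLv : L = opProd (fun l => T l (v l)) k := by rw [hL, huv, moranLinear_take]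
    have hLu : L = opProd (fun l => T l (u l)) k := by rw [hL, moranLinear_take]
    have hprod : ∀ l < k, opProd (fun l => T l (u l)) l = opProd (fun l => T l (v l)) l :=
      fun l hl => by rw [← moranLinear_take, ← moranLinear_take, htake l hl]
    rw [codingMap, codingMap,
      opSeries_eq_sum_add hη0 hη1 (fun l => hη l (u l)) (fun l => norm_le_pi_norm a _) k,
      opSeries_eq_sum_add hη0 hη1 (fun l => hη l (v l)) (fun l => norm_le_pi_norm a _) k,
      ← hLv, ← hLu, hG, map_sub]
    have hsum : ∑ l ∈ Finset.range k, opProd (fun l => T l (u l)) l (a (γ l (u.take l) (u l))) =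
        ∑ l ∈ Finset.range k, opProd (fun l => T l (v l)) l (a (γ l (v.take l) (v l))) := by
      refine Finset.sum_congr rfl fun l hl => ?_
      have hl := Finset.mem_range.1 hl
      rw [hprod l hl, htake l hl, hlt l hl]
    rw [hsum]
    abel
  have hGsub : ∀ a b, G a - G b = G (a - b) := by
    intro a b
    simp only [hG, translations, Pi.sub_apply]
    rw [opSeries_sub hη0 hη1 (fun l => hη _ _) (fun l => norm_le_pi_norm a _)
        (fun l => norm_le_pi_norm b _),
      opSeries_sub hη0 hη1 (fun l => hη _ _) (fun l => norm_le_pi_norm a _)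
        (fun l => norm_le_pi_norm b _)]
    abel
  set p := γ k (u.take k) (u k) with hp
  set q := γ k (v.take k) (v k) with hq
  have hpq : q ≠ p := by
    rw [hp, hq, huv]
    exact fun h => hne (hγ k _ h).symm
  -- Opposite shifts at the two indices where the words part, distinct because `γ` separates
  -- siblings. They double the leading term while the sup norm of the shift stays at most `‖y‖`;
  -- shifting one index alone would require `2 * δ < 1`, that is `η < 1 / 3`.
  set ι : EuclideanSpace ℝ (Fin d) → Fin τ → EuclideanSpace ℝ (Fin d) := fun y i =>
    (if i = p then (1 : ℝ) else if i = q then -1 else 0) • y with hι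
  have hιsub : ∀ y z, ι y - ι z = ι (y - z) := fun y z => funext fun i => by
    simp only [hι, Pi.sub_apply, smul_sub]
  have hιnorm : ∀ y i, ‖ι y i‖ ≤ ‖y‖ := by
    intro y i
    simp only [hι, norm_smul]
    refine mul_le_of_le_one_left (norm_nonneg _) ?_
    split_ifs <;> simp
  have hιm : Measurable ι := measurable_pi_lambda _ fun i => measurable_const_smul _
  have hGι : ∀ y, ‖G (ι y) - (2 : ℝ) • y‖ ≤ 2 * δ * ‖y‖ := by
    intro y
    have h := norm_opSeries_sub_opSeries_sub_le hη0 hη1 (M := ‖y‖)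
      (S := fun l => T (l + k) (u (l + k))) (S' := fun l => T (l + k) (v (l + k)))
      (c := fun l => translations γ (ι y) (l + k) (u.take (l + k)) (u (l + k)))
      (c' := fun l => translations γ (ι y) (l + k) (v.take (l + k)) (v (l + k)))
      (fun l => hη _ _) (fun l => hη _ _) (fun l => hιnorm y _) (fun l => hιnorm y _)
    have h0 : ∀ x : MoranInfWord n, translations γ (ι y) (0 + k) (x.take (0 + k)) (x (0 + k)) =
        ι y (γ k (x.take k) (x k)) := fun x => by
      have : ∀ m, m = k → translations γ (ι y) m (x.take m) (x m) = ι y (γ k (x.take k) (x k)) := by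
        rintro m rfl
        rfl
      exact this _ (zero_add k)
    simp only [h0] at h
    rw [← hp, ← hq] at h
    have hyp : ι y p - ι y q = (2 : ℝ) • y := by
      simp only [hι, if_true, if_neg hpq]
      rw [two_smul, one_smul, neg_one_smul, sub_neg_eq_add]
    rw [hyp] at h
    refine h.trans (le_of_eq ?_)
    rw [hδ]
    ring
  have hanti : ∀ a, AntilipschitzWith K fun y => G (a + ι y) := by
    intro a
    refine AntilipschitzWith.of_le_mul_dist fun y z => ?_
    rw [dist_eq_norm, dist_eq_norm, hGsub, add_sub_add_left_eq_sub, hιsub]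
    have h1 := hGι (y - z)
    have h2 : 2 * ‖y - z‖ ≤ ‖G (ι (y - z))‖ + 2 * δ * ‖y - z‖ := by
      have := norm_sub_norm_le ((2 : ℝ) • (y - z)) (G (ι (y - z)))
      rw [norm_sub_rev ((2 : ℝ) • (y - z)), norm_smul] at this
      simp only [Real.norm_ofNat] at this
      linarith
    change ‖y - z‖ ≤ (2 - 2 * δ)⁻¹ * _
    rw [← div_eq_inv_mul, le_div_iff₀ (by linarith)]
    linarith
  have hSm : MeasurableSet S := by
    have h1 : ∀ x, Measurable fun a : Fin τ → EuclideanSpace ℝ (Fin d) =>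
        codingMap T (translations γ a) x := fun x =>
      (measurable_codingMap hη0 hη1 hη).comp (measurable_id.prodMk measurable_const)
    exact (measurableSet_le measurable_norm measurable_const).inter
      (measurableSet_le ((h1 u).sub (h1 v)).norm measurable_const)
  -- The radius 4 comes from `‖G (ι y)‖ ≤ (2 + 2 * δ) * ‖y‖ ≤ 4` on the unit ball `B`. The radius `ρ
  -- + 1` of `D` allows for a shift of norm at most 1.
  have hmain := measure_mul_measure_le_of_translates (ν := volume) (μ := volume) hιm
    (B := B) (S := S) (D := D) Metric.isClosed_closedBall.measurableSet hSm
    Metric.isClosed_closedBall.measurableSet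
    (K := (K : ℝ≥0∞) ^ (d : ℝ) *
      ENNReal.ofReal ((2 * 4) ^ d * r ^ (t : ℝ) / singularValueFunction t L))
    (fun a => by
      refine le_trans (measure_mono ?_) (((hanti a).volume_preimage_le _).trans
        (mul_le_mul_right (volume_norm_le_and_norm_sub_le L (moranLinear_injective hT _ _) ht hr
          (show (1 : ℝ) ≤ 4 by norm_num) (G a)) _))
      rintro y ⟨hy, hy1, hy2⟩
      refine ⟨hdiff (a + ι y) ▸ hy2, ?_⟩
      rw [hGsub, add_sub_cancel_left]
      have hy : ‖y‖ ≤ 1 := mem_closedBall_zero_iff.1 hy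
      have h1 := hGι y
      have h2 := norm_sub_norm_le (G (ι y)) ((2 : ℝ) • y)
      rw [norm_smul] at h2
      simp only [Real.norm_ofNat] at h2
      nlinarith [norm_nonneg y])
    (fun a y hy hay => by
      have hy : ‖y‖ ≤ 1 := mem_closedBall_zero_iff.1 hy
      refine mem_closedBall_zero_iff.2 ?_
      calc ‖a‖ = ‖(a + ι y) - ι y‖ := by rw [add_sub_cancel_right]
        _ ≤ ‖a + ι y‖ + ‖ι y‖ := norm_sub_le _ _
        _ ≤ ρ + 1 := add_le_add hay.1 (((pi_norm_le_iff_of_nonneg (norm_nonneg y)).2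
          (hιnorm y)).trans hy))
  calc volume S = (volume B)⁻¹ * (volume B * volume S) := by
        rw [← mul_assoc, ENNReal.inv_mul_cancel hB0 hBtop, one_mul]
    _ ≤ _ := mul_le_mul_right hmain _
    _ = _ := by
        rw [mul_div_assoc, ENNReal.ofReal_mul (by positivity)]
        ring

end Transversality

/-! ### Correlation integrals -/

section Correlation

variable {X : Type*} [PseudoMetricSpace X] [SecondCountableTopology X] [MeasurableSpace X]
  [OpensMeasurableSpace X]

/-- The measure of the pairs of points at distance at most `r`. -/
def correlation (ν : Measure X) (r : ℝ) : ℝ≥0∞ := ∫⁻ x, ν (Metric.closedBall x r) ∂ν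

theorem measurable_measure_closedBall (ν : Measure X) [SFinite ν] (r : ℝ) :
    Measurable fun x => ν (Metric.closedBall x r) := by
  have hm : MeasurableSet {p : X × X | dist p.2 p.1 ≤ r} :=
    measurableSet_le (measurable_snd.dist measurable_fst) measurable_const
  exact measurable_measure_prodMk_left hm

theorem correlation_map {Ω : Type*} [MeasurableSpace Ω] (μ : Measure Ω) [SFinite μ] {f : Ω → X}
    (hf : Measurable f) (r : ℝ) :
    correlation (μ.map f) r = (μ.prod μ) {p | dist (f p.1) (f p.2) ≤ r} := by
  have hm : MeasurableSet {p : Ω × Ω | dist (f p.1) (f p.2) ≤ r} :=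
    measurableSet_le ((hf.comp measurable_fst).dist (hf.comp measurable_snd)) measurable_const
  rw [correlation, lintegral_map (measurable_measure_closedBall _ r) hf, Measure.prod_apply hm]
  refine lintegral_congr fun u => ?_
  rw [Measure.map_apply hf Metric.isClosed_closedBall.measurableSet]
  congr 1
  ext v
  simp [dist_comm]

end Correlation

/-! ### From correlations to Hausdorff measure and volume -/

section MassDistribution

variable {X : Type*} [MetricSpace X] [SecondCountableTopology X] [MeasurableSpace X] [BorelSpace X]

/-- The series is the `ν`-integral of `F`, so `F` is bounded by some `M` on a set of positive
measure. There, balls of dyadic radius `r` have mass at most `(M + 1) * r ^ t`, and the mass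
distribution principle applies to the restriction of `ν`. -/
theorem hausdorffMeasure_ne_zero_of_correlation {ν : Measure X} [IsProbabilityMeasure ν]
    {A : Set X} (hA : MeasurableSet A) (hνA : ν A = 1) {t : ℝ} (ht : 0 < t)
    (h : ∑' N : ℕ, correlation ν ((1 / 2) ^ N) / ENNReal.ofReal (((1 / 2 : ℝ) ^ N) ^ t) ≠ ∞) :
    μH[t] A ≠ 0 := by
  set F : X → ℝ≥0∞ := fun x =>
    ∑' N : ℕ, ν (Metric.closedBall x ((1 / 2) ^ N)) / ENNReal.ofReal (((1 / 2 : ℝ) ^ N) ^ t) with hF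
  have hFm : Measurable F :=
    Measurable.tsum fun N => (measurable_measure_closedBall ν _).div_const _
  have hFint : ∫⁻ x, F x ∂ν ≠ ∞ := by
    rw [hF, lintegral_tsum fun N => ((measurable_measure_closedBall ν _).div_const _).aemeasurable]
    convert h using 3 with N
    simp only [div_eq_mul_inv, correlation]
    rw [lintegral_mul_const _ (measurable_measure_closedBall ν _)]
  have hae := ae_lt_top hFm hFint
  obtain ⟨M, hM⟩ : ∃ M : ℕ, ν {x | F x ≤ M} ≠ 0 := by
    by_contra! hcon
    have h0 : ν (⋃ M : ℕ, {x | F x ≤ M}) = 0 := measure_iUnion_null hcon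
    have h1 : ∀ᵐ x ∂ν, x ∈ ⋃ M : ℕ, {x | F x ≤ M} := by
      filter_upwards [hae] with x hx
      obtain ⟨M, hM⟩ := ENNReal.exists_nat_gt hx.ne
      exact Set.mem_iUnion.2 ⟨M, hM.le⟩
    have h2 : ν (⋃ M : ℕ, {x | F x ≤ M}) = 1 := by
      have h3 : (⋃ M : ℕ, {x | F x ≤ M}) =ᵐ[ν] Set.univ := eventuallyEq_univ.2 h1
      rw [measure_congr h3, measure_univ]
    exact zero_ne_one (h0.symm.trans h2)
  set S : Set X := {x | F x ≤ M} with hS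
  have hSm : MeasurableSet S := measurableSet_le hFm measurable_const
  have hball : ∀ x ∈ S, ∀ N : ℕ, ν (Metric.closedBall x ((1 / 2) ^ N)) ≤
      ((M : ℝ≥0∞) + 1) * ENNReal.ofReal (((1 / 2 : ℝ) ^ N) ^ t) := by
    intro x hx N
    have h1 : ν (Metric.closedBall x ((1 / 2) ^ N)) / ENNReal.ofReal (((1 / 2 : ℝ) ^ N) ^ t) ≤ M + 1 :=
      (ENNReal.le_tsum N).trans ((show F x ≤ M from hx).trans le_self_add)
    rwa [ENNReal.div_le_iff (by simp; positivity) ENNReal.ofReal_ne_top] at h1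
  -- The factor `2 ^ t` pays for rounding a diameter up to a power of `1 / 2`.
  set K : ℝ≥0∞ := ((M : ℝ≥0∞) + 1) * ENNReal.ofReal (2 ^ t) with hK
  have hK0 : K ≠ 0 := by simp [hK]; positivity
  have hKtop : K ≠ ∞ := ENNReal.mul_ne_top (by simp) ENNReal.ofReal_ne_top
  have hset : ∀ s : Set X, Metric.ediam s ≤ 1 → ν.restrict S s ≤ K * Metric.ediam s ^ t := by
    intro s hs
    rw [Measure.restrict_apply' hSm]
    rcases (s ∩ S).eq_empty_or_nonempty with he | ⟨x, hxs, hxS⟩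
    · simp [he]
    have hle : ∀ N : ℕ, Metric.ediam s ≤ ENNReal.ofReal ((1 / 2) ^ N) →
        ν (s ∩ S) ≤ ((M : ℝ≥0∞) + 1) * ENNReal.ofReal (((1 / 2 : ℝ) ^ N) ^ t) := by
      intro N hN
      refine (measure_mono fun y hy => ?_).trans (hball x hxS N)
      rw [Metric.mem_closedBall, ← ENNReal.ofReal_le_ofReal_iff (by positivity), ← edist_dist]
      exact (Metric.edist_le_ediam_of_mem hy.1 hxs).trans hN
    have hfin : Metric.ediam s ≠ ∞ := (hs.trans_lt ENNReal.one_lt_top).ne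
    rcases eq_or_ne (Metric.ediam s) 0 with h0 | h0
    · have hlim : Tendsto (fun N : ℕ => ((M : ℝ≥0∞) + 1) *
          ENNReal.ofReal (((1 / 2 : ℝ) ^ N) ^ t)) atTop (𝓝 0) := by
        have h1 : Tendsto (fun N : ℕ => ((1 / 2 : ℝ) ^ N) ^ t) atTop (𝓝 (0 ^ t)) :=
          (tendsto_pow_atTop_nhds_zero_of_lt_one (by norm_num) (by norm_num)).rpow_const
            (Or.inr ht.le)
        rw [Real.zero_rpow ht.ne'] at h1
        have h2 := ENNReal.Tendsto.const_mul (a := (M : ℝ≥0∞) + 1) (ENNReal.tendsto_ofReal h1)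
          (Or.inr (by simp))
        simpa using h2
      refine le_trans (ge_of_tendsto' hlim fun N => hle N (by simp [h0])) bot_le
    · set δ := (Metric.ediam s).toReal with hδ
      have hδs : Metric.ediam s = ENNReal.ofReal δ := (ENNReal.ofReal_toReal hfin).symm
      have hδ0 : 0 < δ := ENNReal.toReal_pos h0 hfin
      have hδ1 : δ ≤ 1 := ENNReal.toReal_le_of_le_ofReal zero_le_one (by simpa using hs)
      obtain ⟨N, hN1, hN2⟩ := exists_nat_pow_near_of_lt_one hδ0 hδ1
        (show (0 : ℝ) < 1 / 2 by norm_num) (by norm_num)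
      refine (hle N (hδs ▸ ENNReal.ofReal_le_ofReal hN2)).trans ?_
      rw [hK, mul_assoc, hδs, ENNReal.ofReal_rpow_of_pos hδ0, ← ENNReal.ofReal_mul (by positivity),
        ← Real.mul_rpow (by norm_num) hδ0.le]
      gcongr
      rw [pow_succ] at hN1
      linarith
  have hH : K⁻¹ • ν.restrict S ≤ μH[t] := by
    refine Measure.le_hausdorffMeasure t _ 1 one_pos fun s hs => ?_
    rw [Measure.smul_apply, smul_eq_mul]
    calc K⁻¹ * ν.restrict S s ≤ K⁻¹ * (K * Metric.ediam s ^ t) := mul_le_mul_right (hset s hs) _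
      _ = Metric.ediam s ^ t := by rw [← mul_assoc, ENNReal.inv_mul_cancel hK0 hKtop, one_mul]
  intro hzero
  have h1 := Measure.le_iff'.1 hH A
  rw [hzero, Measure.smul_apply, smul_eq_mul, nonpos_iff_eq_zero, mul_eq_zero,
    Measure.restrict_apply hA] at h1
  rcases h1 with h1 | h1
  · exact ENNReal.inv_ne_zero.2 hKtop h1
  · refine hM ?_
    have hc : ν Aᶜ = 0 := (prob_compl_eq_zero_iff hA).2 hνA
    refine le_antisymm ?_ bot_le
    calc ν S ≤ ν (A ∩ S ∪ Aᶜ) := measure_mono fun x hx => by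
          by_cases hxA : x ∈ A
          · exact Or.inl ⟨hxA, hx⟩
          · exact Or.inr hxA
      _ ≤ ν (A ∩ S) + ν Aᶜ := measure_union_le _ _
      _ = 0 := by rw [h1, hc, add_zero]

/-- By Fatou, `ν(B(x, r)) / r ^ d` has finite lower limit along dyadic radii for `ν`-almost every
`x`. Where the derivative of volume with respect to `ν` vanished, Besicovitch differentiation would
force this ratio to infinity. The derivative is thus positive `ν`-almost everywhere, and its
integral over `A` is at most the volume of `A`. -/
theorem volume_pos_of_correlation {d : ℕ} {ν : Measure (EuclideanSpace ℝ (Fin d))}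
    [IsProbabilityMeasure ν] {A : Set (EuclideanSpace ℝ (Fin d))} (hA : MeasurableSet A)
    (hνA : ν A = 1)
    (h : liminf (fun N : ℕ => correlation ν ((1 / 2) ^ N) /
      ENNReal.ofReal (((1 / 2 : ℝ) ^ N) ^ (d : ℝ))) atTop ≠ ∞) :
    0 < volume A := by
  have hfatou : ∫⁻ x, liminf (fun N : ℕ => ν (Metric.closedBall x ((1 / 2) ^ N)) /
      ENNReal.ofReal (((1 / 2 : ℝ) ^ N) ^ (d : ℝ))) atTop ∂ν ≠ ∞ := by
    refine ne_top_of_le_ne_top h (le_trans (lintegral_liminf_le fun N =>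
      (measurable_measure_closedBall ν _).div_const _) (le_of_eq ?_))
    congr 1
    funext N
    simp only [div_eq_mul_inv, correlation]
    rw [lintegral_mul_const _ (measurable_measure_closedBall ν _)]
  have hae := ae_lt_top (Measurable.liminf fun N =>
    (measurable_measure_closedBall ν ((1 / 2) ^ N)).div_const _) hfatou
  have hD : ∀ᵐ x ∂ν, (volume : Measure (EuclideanSpace ℝ (Fin d))).rnDeriv ν x ≠ 0 := by
    filter_upwards [hae, Besicovitch.ae_tendsto_rnDeriv volume ν] with x hx hlim h0
    rw [h0] at hlim
    set c := volume (Metric.ball (0 : EuclideanSpace ℝ (Fin d)) 1) with hc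
    have hc0 : c ≠ 0 := (Metric.measure_ball_pos _ _ one_pos).ne'
    have hctop : c ≠ ∞ := measure_ball_lt_top.ne
    have hr : Tendsto (fun N : ℕ => (1 / 2 : ℝ) ^ N) atTop (𝓝[>] 0) :=
      tendsto_nhdsWithin_iff.2 ⟨tendsto_pow_atTop_nhds_zero_of_lt_one (by norm_num) (by norm_num),
        Eventually.of_forall fun N => by simp⟩
    have h1 := (tendsto_inv_iff.2 (hlim.comp hr))
    rw [ENNReal.inv_zero] at h1
    have h2 := ENNReal.Tendsto.const_mul (a := c) h1 (Or.inl (by simp))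
    rw [ENNReal.mul_top hc0] at h2
    have h3 : ∀ N : ℕ, c * (((fun r => volume (Metric.closedBall x r) / ν (Metric.closedBall x r)) ∘
        fun N : ℕ => (1 / 2 : ℝ) ^ N) N)⁻¹ = ν (Metric.closedBall x ((1 / 2) ^ N)) /
          ENNReal.ofReal (((1 / 2 : ℝ) ^ N) ^ (d : ℝ)) := by
      intro N
      have hpow : (0 : ℝ) < (1 / 2) ^ N := by positivity
      have hb : volume (Metric.closedBall x ((1 / 2 : ℝ) ^ N)) =
          ENNReal.ofReal (((1 / 2 : ℝ) ^ N) ^ (d : ℝ)) * c := by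
        rw [Measure.addHaar_closedBall _ _ hpow.le, finrank_euclideanSpace, Fintype.card_fin,
          Real.rpow_natCast]
      have hne : ENNReal.ofReal (((1 / 2 : ℝ) ^ N) ^ (d : ℝ)) * c ≠ 0 :=
        mul_ne_zero (ENNReal.ofReal_pos.2 (Real.rpow_pos_of_pos hpow _)).ne' hc0
      rw [Function.comp_apply, hb, ENNReal.inv_div (Or.inl (measure_ne_top _ _)) (Or.inr hne)]
      generalize ν (Metric.closedBall x ((1 / 2) ^ N)) = y
      generalize ENNReal.ofReal (((1 / 2 : ℝ) ^ N) ^ (d : ℝ)) = z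
      rw [div_eq_mul_inv, div_eq_mul_inv, ENNReal.mul_inv (Or.inr hctop) (Or.inr hc0), mul_left_comm,
        mul_comm _ c⁻¹, ← mul_assoc c, ENNReal.mul_inv_cancel hc0 hctop, one_mul]
    have h4 := (tendsto_congr h3).1 h2
    exact hx.ne h4.liminf_eq
  by_contra hzero
  have hzero : volume A = 0 := by simpa using hzero
  have h1 : ν.withDensity (volume.rnDeriv ν) A ≤ volume A :=
    Measure.le_iff'.1 (Measure.withDensity_rnDeriv_le volume ν) A
  rw [hzero, nonpos_iff_eq_zero, withDensity_apply _ hA,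
    lintegral_eq_zero_iff (Measure.measurable_rnDeriv _ _)] at h1
  have h2 : ∀ᵐ x ∂ν.restrict A, False := by
    filter_upwards [h1, ae_restrict_of_ae hD] with x hx hx'
    exact hx' hx
  rw [eventually_false_iff_eq_bot, ae_eq_bot, Measure.restrict_eq_zero, hνA] at h2
  exact one_ne_zero h2

end MassDistribution

/-! ### Averaging over the parameters -/

section AlmostAllParameters

variable {d : ℕ} {n : ℕ → ℕ}
  {T : ∀ k, Fin (n k) → (EuclideanSpace ℝ (Fin d) →L[ℝ] EuclideanSpace ℝ (Fin d))}
  {η : ℝ} {τ : ℕ} {γ : ∀ k, MoranWord n k → Fin (n k) → Fin τ}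

theorem sum_measure_cylinder (μ : Measure (MoranInfWord n)) [IsProbabilityMeasure μ] (k : ℕ) :
    ∑ v : MoranWord n k, μ v.cylinder = 1 := by
  simp only [MoranWord.cylinder_eq_preimage]
  rw [sum_measure_preimage_singleton _ fun v _ =>
    MoranInfWord.measurable_take k (measurableSet_singleton v)]
  simp

theorem ENNReal.tsum_ofReal_pow_ne_top {θ : ℝ} (h0 : 0 ≤ θ) (h1 : θ < 1) :
    ∑' k : ℕ, ENNReal.ofReal (θ ^ k) ≠ ∞ := by
  rw [← ENNReal.ofReal_tsum_of_nonneg (fun k => pow_nonneg h0 k)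
    (summable_geometric_of_lt_one h0 h1)]
  exact ENNReal.ofReal_ne_top

theorem measurableSet_dist_codingMap_le (hη0 : 0 ≤ η) (hη1 : η < 1) (hη : ∀ k j, ‖T k j‖ ≤ η)
    (r : ℝ) :
    MeasurableSet {q : (Fin τ → EuclideanSpace ℝ (Fin d)) × (MoranInfWord n × MoranInfWord n) |
      dist (codingMap T (translations γ q.1) q.2.1) (codingMap T (translations γ q.1) q.2.2) ≤ r} :=
  have h := measurable_codingMap (γ := γ) hη0 hη1 hη
  measurableSet_le ((h.comp (measurable_fst.prodMk (measurable_fst.comp measurable_snd))).dist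
    (h.comp (measurable_fst.prodMk (measurable_snd.comp measurable_snd)))) measurable_const

theorem measurable_codingMap_right (hη0 : 0 ≤ η) (hη1 : η < 1) (hη : ∀ k j, ‖T k j‖ ≤ η)
    (a : Fin τ → EuclideanSpace ℝ (Fin d)) : Measurable (codingMap T (translations γ a)) :=
  (measurable_codingMap hη0 hη1 hη).comp (measurable_const.prodMk measurable_id)

theorem measurable_correlation_codingMap (hη0 : 0 ≤ η) (hη1 : η < 1) (hη : ∀ k j, ‖T k j‖ ≤ η)
    (μ : Measure (MoranInfWord n)) [IsProbabilityMeasure μ] (r : ℝ) :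
    Measurable fun a => correlation (μ.map (codingMap T (translations γ a))) r := by
  simp only [fun a => correlation_map μ (measurable_codingMap_right (γ := γ) hη0 hη1 hη a) r]
  exact measurable_measure_prodMk_left (measurableSet_dist_codingMap_le hη0 hη1 hη r)

/-- The mean over a ball of parameters of the correlations of the projected measure. -/
theorem exists_lintegral_correlation_le (hη0 : 0 ≤ η) (hη2 : η < 1 / 2)
    (hη : ∀ k j, ‖T k j‖ ≤ η) (hT : ∀ k j, Function.Injective (T k j))
    (hγ : ∀ k u, Function.Injective (γ k u)) {μ : Measure (MoranInfWord n)}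
    [IsProbabilityMeasure μ] {C : ℝ≥0∞} (hC : C ≠ ∞) {s t : ℝ≥0} {θ : ℝ} (hθ0 : 0 ≤ θ)
    (hθ1 : θ < 1) (ht : t ≤ d)
    (hμ : ∀ k (u : MoranWord n k),
      μ u.cylinder ≤ C * ENNReal.ofReal (singularValueFunction s (moranLinear T k u)))
    (hst : ∀ k (u : MoranWord n k), singularValueFunction s (moranLinear T k u) ≤
      θ ^ k * singularValueFunction t (moranLinear T k u)) (ρ : ℝ) :
    ∃ C' : ℝ≥0∞, C' ≠ ∞ ∧ ∀ r : ℝ, 0 < r →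
      ∫⁻ a in Metric.closedBall (0 : Fin τ → EuclideanSpace ℝ (Fin d)) ρ,
        correlation (μ.map (codingMap T (translations γ a))) r ≤
      C' * ENNReal.ofReal (r ^ (t : ℝ)) := by
  have hη1 : η < 1 := by linarith
  obtain ⟨C₀, hC₀, hvol⟩ := exists_volume_norm_codingMap_sub_le hη0 hη2 hη hT hγ ρ
  -- Enlarged to be nonzero: on the diagonal `u = v` the majorant `∑' k, h k p` must be infinite,
  -- and its terms there are at least `C₁ * r ^ t` because `φ^t ≤ 1`.
  set C₁ := C₀ + 1 with hC₁
  refine ⟨C₁ * C * ∑' k : ℕ, ENNReal.ofReal (θ ^ k), ENNReal.mul_ne_top (ENNReal.mul_ne_top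
    (ENNReal.add_ne_top.2 ⟨hC₀, ENNReal.one_ne_top⟩) hC)
    (ENNReal.tsum_ofReal_pow_ne_top hθ0 hθ1), fun r hr => ?_⟩
  have hφ : ∀ k (u : MoranWord n k), 0 < singularValueFunction t (moranLinear T k u) :=
    fun k u => singularValueFunction_pos _ (moranLinear_injective hT k u) t
  set D := Metric.closedBall (0 : Fin τ → EuclideanSpace ℝ (Fin d)) ρ with hD
  set κ : ∀ k, MoranWord n k → ℝ≥0∞ := fun k v =>
    C₁ * ENNReal.ofReal (r ^ (t : ℝ) / singularValueFunction t (moranLinear T k v)) with hκ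
  -- Summing over all common prefixes, not just the longest, keeps the majorant a series of product
  -- indicators; transversality bounds the term at the branching level.
  set h : ℕ → MoranInfWord n × MoranInfWord n → ℝ≥0∞ := fun k p =>
    ∑ v : MoranWord n k, (v.cylinder ×ˢ v.cylinder).indicator (fun _ => κ k v) p with hh
  have hhm : ∀ k (v : MoranWord n k), Measurable fun p =>
      (v.cylinder ×ˢ v.cylinder).indicator (fun _ : MoranInfWord n × MoranInfWord n => κ k v) p :=
    fun k v => measurable_const.indicator
      (v.measurableSet_cylinder.prod v.measurableSet_cylinder)
  have hhge : ∀ k (p : MoranInfWord n × MoranInfWord n), p.1.take k = p.2.take k →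
      κ k (p.1.take k) ≤ h k p := by
    intro k p hp
    refine le_trans (le_of_eq ?_) (Finset.single_le_sum (f := fun v : MoranWord n k =>
      (v.cylinder ×ˢ v.cylinder).indicator (fun _ => κ k v) p) (fun _ _ => zero_le)
      (Finset.mem_univ (p.1.take k)))
    have hmem : p ∈ (p.1.take k).cylinder ×ˢ (p.1.take k).cylinder :=
      ⟨(MoranWord.mem_cylinder_iff _ _).2 rfl, (MoranWord.mem_cylinder_iff _ _).2 hp.symm⟩
    exact (Set.indicator_of_mem hmem (fun _ => κ k (p.1.take k))).symm
  have hpt : ∀ p : MoranInfWord n × MoranInfWord n,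
      volume {a : Fin τ → EuclideanSpace ℝ (Fin d) | a ∈ D ∧
        dist (codingMap T (translations γ a) p.1) (codingMap T (translations γ a) p.2) ≤ r} ≤
      ∑' k, h k p := by
    rintro ⟨u, v⟩
    by_cases huv : u = v
    · subst huv
      have hε : C₁ * ENNReal.ofReal (r ^ (t : ℝ)) ≠ 0 :=
        mul_ne_zero (by simp [hC₁]) (ENNReal.ofReal_pos.2 (Real.rpow_pos_of_pos hr _)).ne'
      have htop : ∑' k, h k (u, u) = ∞ := by
        refine top_unique ((ENNReal.tsum_const_eq_top_of_ne_zero (α := ℕ) hε).symm.le.trans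
          (ENNReal.tsum_le_tsum fun k => le_trans ?_ (hhge k (u, u) rfl)))
        refine mul_le_mul_right (ENNReal.ofReal_le_ofReal ?_) _
        rw [le_div_iff₀ (hφ _ _)]
        refine mul_le_of_le_one_right (Real.rpow_nonneg hr.le _) ?_
        exact singularValueFunction_le_one _ (moranLinear_injective hT _ _)
          ((norm_moranLinear_le hη _ _).trans (pow_le_one₀ hη0 hη1.le)) ht
      rw [htop]
      exact le_top
    · have hex : ∃ k, u k ≠ v k := Function.ne_iff.1 huv
      classical
      have htake : u.take (Nat.find hex) = v.take (Nat.find hex) := funext fun i =>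
        not_not.1 (Nat.find_min hex i.2)
      refine le_trans ?_ (ENNReal.le_tsum (Nat.find hex))
      refine le_trans ?_ (hhge (Nat.find hex) (u, v) htake)
      have hv := hvol t r u v (Nat.find hex) ht hr htake (Nat.find_spec hex)
      refine le_trans (measure_mono fun a ha => ?_)
        (hv.trans (mul_le_mul_left (le_self_add : C₀ ≤ C₁) _))
      exact ⟨mem_closedBall_zero_iff.1 ha.1, dist_eq_norm (codingMap T (translations γ a) u) _ ▸ ha.2⟩
  have hQm := measurableSet_dist_codingMap_le (γ := γ) hη0 hη1 hη r
  have hDm : MeasurableSet D := Metric.isClosed_closedBall.measurableSet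
  calc ∫⁻ a in D, correlation (μ.map (codingMap T (translations γ a))) r
      = ((volume.restrict D).prod (μ.prod μ))
          {q : (Fin τ → EuclideanSpace ℝ (Fin d)) × (MoranInfWord n × MoranInfWord n) |
            dist (codingMap T (translations γ q.1) q.2.1)
              (codingMap T (translations γ q.1) q.2.2) ≤ r} := by
        rw [Measure.prod_apply hQm]
        exact lintegral_congr fun a =>
          correlation_map μ (measurable_codingMap_right hη0 hη1 hη a) r
    _ ≤ ∫⁻ p, ∑' k, h k p ∂(μ.prod μ) := by
        rw [Measure.prod_apply_symm hQm]
        refine lintegral_mono fun p => le_trans (le_of_eq ?_) (hpt p)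
        rw [Measure.restrict_apply' hDm, Set.inter_comm]
        rfl
    _ = ∑' k, ∑ v : MoranWord n k, κ k v * (μ v.cylinder * μ v.cylinder) := by
        rw [lintegral_tsum fun k => (Finset.measurable_fun_sum _ fun v _ => hhm k v).aemeasurable]
        refine tsum_congr fun k => ?_
        rw [lintegral_finsetSum _ fun v _ => hhm k v]
        refine Finset.sum_congr rfl fun v _ => ?_
        rw [lintegral_indicator_const (v.measurableSet_cylinder.prod v.measurableSet_cylinder),
          Measure.prod_prod]
    -- One factor `μ v.cylinder` is traded for `C * φ^s ≤ C * θ ^ k * φ^t`, cancelling the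
    -- denominator; the other sums to 1 over each level.
    _ ≤ ∑' k, ∑ v : MoranWord n k,
          C₁ * C * ENNReal.ofReal (r ^ (t : ℝ)) * ENNReal.ofReal (θ ^ k) * μ v.cylinder := by
        refine ENNReal.tsum_le_tsum fun k => Finset.sum_le_sum fun v _ => ?_
        rw [← mul_assoc]
        refine mul_le_mul_left ?_ _
        calc κ k v * μ v.cylinder ≤ κ k v *
              (C * ENNReal.ofReal (singularValueFunction s (moranLinear T k v))) :=
              mul_le_mul_right (hμ k v) _
          _ = C₁ * C * ENNReal.ofReal (r ^ (t : ℝ) / singularValueFunction t (moranLinear T k v) *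
                singularValueFunction s (moranLinear T k v)) := by
              rw [hκ, ENNReal.ofReal_mul (div_nonneg (Real.rpow_nonneg hr.le _) (hφ k v).le)]
              ring
          _ ≤ C₁ * C * ENNReal.ofReal (r ^ (t : ℝ) * θ ^ k) := by
              refine mul_le_mul_right (ENNReal.ofReal_le_ofReal ?_) _
              rw [div_mul_eq_mul_div, div_le_iff₀ (hφ k v), mul_assoc]
              exact mul_le_mul_of_nonneg_left (hst k v) (Real.rpow_nonneg hr.le _)
          _ = _ := by
              rw [ENNReal.ofReal_mul (Real.rpow_nonneg hr.le _), mul_assoc _ _ (ENNReal.ofReal (θ ^ k))]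
    _ = _ := by
        simp only [← Finset.mul_sum, sum_measure_cylinder, mul_one]
        rw [ENNReal.tsum_mul_left]
        ring

theorem ae_of_forall_ae_restrict_closedBall {V : Type*} [NormedAddCommGroup V] [MeasurableSpace V]
    {μ : Measure V} {P : V → Prop}
    (h : ∀ ρ : ℕ, ∀ᵐ a ∂μ.restrict (Metric.closedBall 0 ρ), P a) : ∀ᵐ a ∂μ, P a := by
  rw [← Measure.restrict_univ (μ := μ), ← Metric.iUnion_closedBall_nat (0 : V),
    ae_restrict_iUnion_iff]
  exact h

theorem isClosed_moranSet {w : ∀ k, MoranWord n k → Fin (n k) → EuclideanSpace ℝ (Fin d)}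
    {J : Set (EuclideanSpace ℝ (Fin d))} (hJ : IsCompact J) : IsClosed (moranSet T w J) :=
  isClosed_iInter fun k => isClosed_iUnion_of_finite fun u =>
    (isCompact_moranBasicSet hJ (k + 1) u).isClosed

theorem map_codingMap_moranSet (hη0 : 0 ≤ η) (hη1 : η < 1) (hη : ∀ k j, ‖T k j‖ ≤ η)
    (μ : Measure (MoranInfWord n)) [IsProbabilityMeasure μ]
    {a : Fin τ → EuclideanSpace ℝ (Fin d)} {J : Set (EuclideanSpace ℝ (Fin d))}
    (hJ : IsSelfAffineMoran T (translations γ a) J) :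
    μ.map (codingMap T (translations γ a)) (moranSet T (translations γ a) J) = 1 := by
  rw [Measure.map_apply (measurable_codingMap_right hη0 hη1 hη a)
    (isClosed_moranSet hJ.isCompact).measurableSet]
  have h : codingMap T (translations γ a) ⁻¹' moranSet T (translations γ a) J = Set.univ :=
    Set.eq_univ_of_forall fun u =>
      codingMap_mem_moranSet hη0 hη1 hη (fun _ _ _ => norm_le_pi_norm a _) hJ u
  rw [h, measure_univ]

theorem ae_le_dimH_moranSet (hn : ∀ k, 0 < n k) (hη0 : 0 ≤ η) (hη2 : η < 1 / 2)
    (hη : ∀ k j, ‖T k j‖ ≤ η) (hT : ∀ k j, Function.Injective (T k j))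
    (hγ : ∀ k u, Function.Injective (γ k u)) {s t : ℝ≥0} (hts : t < s) (hsd : s ≤ d)
    (hs : netMeasure T s Set.univ ≠ 0) :
    ∀ᵐ a : Fin τ → EuclideanSpace ℝ (Fin d), ∀ J, IsSelfAffineMoran T (translations γ a) J →
      (t : ℝ≥0∞) ≤ dimH (moranSet T (translations γ a) J) := by
  have hη1 : η < 1 := by linarith
  rcases eq_or_ne t 0 with rfl | ht0
  · exact Eventually.of_forall fun a J _ => by simp
  have ht0' : (0 : ℝ) < t := by exact_mod_cast pos_iff_ne_zero.2 ht0
  -- The gap `s - t'` gives geometric decay in the word length, and the gap `t' - t` gives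
  -- convergence of the dyadic sum over radii.
  obtain ⟨t', htt', ht's⟩ := exists_between hts
  have htt'r : (t : ℝ) < t' := by exact_mod_cast htt'
  have ht'sr : (t' : ℝ) < s := by exact_mod_cast ht's
  obtain ⟨μ, C, hμ, hC, hcyl⟩ := exists_measure_cylinder_le_singularValueFunction hn hT hs
  refine ae_of_forall_ae_restrict_closedBall fun ρ => ?_
  obtain ⟨C', hC', hint⟩ := exists_lintegral_correlation_le (γ := γ) hη0 hη2 hη hT hγ hC
    (θ := η ^ ((s : ℝ) - t')) (t := t') (Real.rpow_nonneg hη0 _)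
    (Real.rpow_lt_one hη0 hη1 (by linarith)) (ht's.le.trans hsd) hcyl
    (fun k u => (singularValueFunction_le_of_le _ (moranLinear_injective hT k u) ht's.le
      hsd).trans (by
        refine mul_le_mul_of_nonneg_right ?_ (singularValueFunction_pos _
          (moranLinear_injective hT k u) t').le
        rw [Real.rpow_pow_comm hη0]
        exact Real.rpow_le_rpow (norm_nonneg _) (norm_moranLinear_le hη k u) (by linarith))) ρ
  have hmeas : ∀ N : ℕ, Measurable fun a =>
      correlation (μ.map (codingMap T (translations γ a))) ((1 / 2) ^ N) /
        ENNReal.ofReal (((1 / 2 : ℝ) ^ N) ^ (t : ℝ)) := fun N =>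
    (measurable_correlation_codingMap hη0 hη1 hη μ _).div_const _
  have hfin : ∫⁻ a in Metric.closedBall (0 : Fin τ → EuclideanSpace ℝ (Fin d)) ρ,
      ∑' N : ℕ, correlation (μ.map (codingMap T (translations γ a))) ((1 / 2) ^ N) /
        ENNReal.ofReal (((1 / 2 : ℝ) ^ N) ^ (t : ℝ)) ≠ ∞ := by
    rw [lintegral_tsum fun N => (hmeas N).aemeasurable]
    have hθ : ((1 / 2 : ℝ) ^ ((t' : ℝ) - t)) < 1 :=
      Real.rpow_lt_one (by norm_num) (by norm_num) (by linarith)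
    refine ne_top_of_le_ne_top (ENNReal.mul_ne_top hC'
      (ENNReal.tsum_ofReal_pow_ne_top (by positivity) hθ)) ?_
    rw [← ENNReal.tsum_mul_left]
    refine ENNReal.tsum_le_tsum fun N => ?_
    have hN : (0 : ℝ) < (1 / 2) ^ N := by positivity
    simp only [div_eq_mul_inv (correlation _ _)]
    rw [lintegral_mul_const _ (measurable_correlation_codingMap hη0 hη1 hη μ _), ← div_eq_mul_inv]
    refine ENNReal.div_le_of_le_mul ((hint _ hN).trans (le_of_eq ?_))
    rw [mul_assoc, ← ENNReal.ofReal_mul (by positivity), Real.rpow_pow_comm (by norm_num),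
      ← Real.rpow_add hN, sub_add_cancel]
  filter_upwards [ae_lt_top (Measurable.tsum hmeas) hfin] with a ha J hJ
  have hprob : IsProbabilityMeasure (μ.map (codingMap T (translations γ a))) :=
    Measure.isProbabilityMeasure_map (measurable_codingMap_right hη0 hη1 hη a).aemeasurable
  exact le_dimH_of_hausdorffMeasure_ne_zero (hausdorffMeasure_ne_zero_of_correlation
    (isClosed_moranSet hJ.isCompact).measurableSet (map_codingMap_moranSet hη0 hη1 hη μ hJ) ht0'
    ha.ne)

theorem ae_volume_moranSet_pos (hd : 0 < d) (hn : ∀ k, 0 < n k) (hη0 : 0 ≤ η) (hη2 : η < 1 / 2)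
    (hη : ∀ k j, ‖T k j‖ ≤ η) (hT : ∀ k j, Function.Injective (T k j))
    (hγ : ∀ k u, Function.Injective (γ k u)) {s : ℝ≥0} (hs : (d : ℝ≥0) < s)
    (hsn : netMeasure T s Set.univ ≠ 0) :
    ∀ᵐ a : Fin τ → EuclideanSpace ℝ (Fin d), ∀ J, IsSelfAffineMoran T (translations γ a) J →
      0 < volume (moranSet T (translations γ a) J) := by
  have hη1 : η < 1 := by linarith
  have hsr : (d : ℝ) < s := by exact_mod_cast hs
  obtain ⟨μ, C, hμ, hC, hcyl⟩ := exists_measure_cylinder_le_singularValueFunction hn hT hsn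
  refine ae_of_forall_ae_restrict_closedBall fun ρ => ?_
  obtain ⟨C', hC', hint⟩ := exists_lintegral_correlation_le (γ := γ) hη0 hη2 hη hT hγ hC
    (θ := η ^ ((s : ℝ) - d)) (t := d) (Real.rpow_nonneg hη0 _)
    (Real.rpow_lt_one hη0 hη1 (by linarith)) le_rfl hcyl
    (fun k u => (singularValueFunction_le_of_lt _ hd (moranLinear_injective hT k u) hs).trans (by
        refine mul_le_mul_of_nonneg_right ?_ (singularValueFunction_pos _
          (moranLinear_injective hT k u) d).le
        rw [Real.rpow_pow_comm hη0]
        exact Real.rpow_le_rpow (norm_nonneg _) (norm_moranLinear_le hη k u) (by linarith))) ρ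
  have hmeas : ∀ N : ℕ, Measurable fun a =>
      correlation (μ.map (codingMap T (translations γ a))) ((1 / 2) ^ N) /
        ENNReal.ofReal (((1 / 2 : ℝ) ^ N) ^ (d : ℝ)) := fun N =>
    (measurable_correlation_codingMap hη0 hη1 hη μ _).div_const _
  have hfin : ∫⁻ a in Metric.closedBall (0 : Fin τ → EuclideanSpace ℝ (Fin d)) ρ,
      liminf (fun N : ℕ => correlation (μ.map (codingMap T (translations γ a))) ((1 / 2) ^ N) /
        ENNReal.ofReal (((1 / 2 : ℝ) ^ N) ^ (d : ℝ))) atTop ≠ ∞ := by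
    -- With `t = d` the mean ratios are bounded but no decay in `N` is left to sum, so Fatou's lemma
    -- replaces the series.
    refine ne_top_of_le_ne_top hC' ((lintegral_liminf_le hmeas).trans ?_)
    refine liminf_le_of_le (by isBoundedDefault) fun b hb => ?_
    obtain ⟨N, hN⟩ := hb.exists
    refine hN.trans ?_
    simp only [div_eq_mul_inv (correlation _ _)]
    rw [lintegral_mul_const _ (measurable_correlation_codingMap hη0 hη1 hη μ _), ← div_eq_mul_inv]
    exact ENNReal.div_le_of_le_mul (hint _ (by positivity))
  filter_upwards [ae_lt_top (Measurable.liminf hmeas) hfin] with a ha J hJ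
  have hprob : IsProbabilityMeasure (μ.map (codingMap T (translations γ a))) :=
    Measure.isProbabilityMeasure_map (measurable_codingMap_right hη0 hη1 hη a).aemeasurable
  exact volume_pos_of_correlation (isClosed_moranSet hJ.isCompact).measurableSet
    (map_codingMap_moranSet hη0 hη1 hη μ hJ) ha.ne

theorem netMeasure_ne_zero_of_lt_criticalValue {s : ℝ≥0} (hs : (s : ℝ≥0∞) < criticalValue T) :
    netMeasure T s Set.univ ≠ 0 := fun h =>
  hs.not_ge (iInf₂_le s h)

end AlmostAllParameters

end

/-! ### Conclusion -/

theorem theorem2p4 (d : ℕ) (hd : 0 < d) (n : ℕ → ℕ) (hn : ∀ k, 2 ≤ n k)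
    (T : ∀ k, Fin (n k) → (EuclideanSpace ℝ (Fin d) →L[ℝ] EuclideanSpace ℝ (Fin d)))
    (hlower : ∃ c : ℝ, 0 < c ∧ ∀ k j, c ≤ (T k j).toLinearMap.singularValues (d - 1))
    (hupper : ∃ η : ℝ, η < 1 / 2 ∧ ∀ k j, ‖T k j‖ ≤ η)
    (τ : ℕ) (γ : ∀ k, MoranWord n k → Fin (n k) → Fin τ)
    (hγ : ∀ k u, Function.Injective (γ k u)) :
    ∀ᵐ a : Fin τ → EuclideanSpace ℝ (Fin d) ∂volume,
      (∃ J, IsSelfAffineMoran T (fun k u j => a (γ k u j)) J) ∧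
      ∀ J, IsSelfAffineMoran T (fun k u j => a (γ k u j)) J →
        (criticalValue T ≤ d →
          dimH (moranSet T (fun k u j => a (γ k u j)) J) = criticalValue T) ∧
        (d < criticalValue T →
          0 < volume (moranSet T (fun k u j => a (γ k u j)) J)) := by
  obtain ⟨c, hc, hlow⟩ := hlower
  obtain ⟨η, hη2, hη⟩ := hupper
  have hn' : ∀ k, 0 < n k := fun k => two_pos.trans_le (hn k)
  have hη0 : 0 ≤ η := (norm_nonneg _).trans (hη 0 ⟨0, hn' 0⟩)
  have hη1 : η < 1 := by linarith
  have hT : ∀ k j, Function.Injective (T k j) := fun k j =>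
    injective_of_singularValues_pos _ (hc.trans_le (hlow k j))
  have hex : ∀ a : Fin τ → EuclideanSpace ℝ (Fin d),
      ∃ J, IsSelfAffineMoran T (fun k u j => a (γ k u j)) J := fun a =>
    exists_isSelfAffineMoran hn' hη0 hη1 hη fun _ _ _ => norm_le_pi_norm a _
  rcases le_or_gt (criticalValue T) d with hcrit | hcrit
  -- Restricting to rational exponents leaves countably many exceptional null sets; each of them
  -- already serves every `J`, since the averaged correlations do not involve `J`.
  · have hae : ∀ q : {q : ℚ // 0 ≤ q ∧ (Real.toNNReal q : ℝ≥0∞) < criticalValue T},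
        ∀ᵐ a : Fin τ → EuclideanSpace ℝ (Fin d), ∀ J, IsSelfAffineMoran T (translations γ a) J →
          (Real.toNNReal q.1 : ℝ≥0∞) ≤ dimH (moranSet T (translations γ a) J) := by
      rintro ⟨q, hq0, hq⟩
      obtain ⟨s, hqs, hs⟩ := ENNReal.lt_iff_exists_nnreal_btwn.1 hq
      exact ae_le_dimH_moranSet hn' hη0 hη2 hη hT hγ (by exact_mod_cast hqs)
        (by exact_mod_cast (hs.le.trans hcrit)) (netMeasure_ne_zero_of_lt_criticalValue hs)
    filter_upwards [ae_all_iff.2 hae] with a ha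
    refine ⟨hex a, fun J hJ => ⟨fun _ => le_antisymm
      (dimH_moranSet_le hn' hT hη0 hη1 hη hJ) ?_, fun h => absurd hcrit h.not_ge⟩⟩
    refine le_of_forall_lt fun b hb => ?_
    obtain ⟨q, hq0, hbq, hq⟩ := ENNReal.lt_iff_exists_rat_btwn.1 hb
    exact hbq.trans_le (ha ⟨q, hq0, hq⟩ J hJ)
  · obtain ⟨s, hds, hs⟩ := ENNReal.lt_iff_exists_nnreal_btwn.1 hcrit
    filter_upwards [ae_volume_moranSet_pos hd hn' hη0 hη2 hη hT hγ (s := s)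
      (by exact_mod_cast hds) (netMeasure_ne_zero_of_lt_criticalValue hs)] with a ha
    exact ⟨hex a, fun J hJ => ⟨fun h => absurd hcrit h.not_gt, fun _ => ha J hJ⟩⟩
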